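/- All graphs are finite and loopless but may have parallel edges (of equal or of different colours). A 2-edge-coloured graph is such a graph $G=(V,E)$ together with a map $\phi:E\to\{1,2\}$. A walk is alternating if any two consecutive edges have different colours; for a closed alternating walk the last and the first edge must also have different colours. A trail is a walk without repeated edges. A 2-edge-coloured graph $G$ is - M-closed if $x$ and $z$ are adjacent whenever $x\neq z$ and some vertex $y$ is joined to $x$ and to $z$ by edges of the same colour; - supereulerian if it has a closed alternating trail with at least one edge that visits every vertex; - trail-colour-connected if for every two distinct vertices $u,v$ there are two alternating $(u,v)$-trails $T_1,T_2$ such that $T_1$ followed by the reverse of $T_2$ is an alternating closed walk. An eulerian factor of $G$ is a collection of pairwise vertex-disjoint induced subgraphs of $G$ that cover all vertices of $G$ and each of which is supereulerian. An extension of a 2-edge-coloured graph $G_0$ with vertices $v_1,\dots,v_n$, $n>1$, is a graph obtained from $G_0$ by replacing each vertex $v_i$ by an independent set $I_i$ of $p_i\ge 1$ vertices and each edge of colour $c$ between $v_i$ and $v_j$ by edges of colour $c$, one between each vertex of $I_i$ and each vertex of $I_j$. **Theorem.** Let $G$ be an extension of an M-closed 2-edge-coloured graph with more than one vertex. Then $G$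 is supereulerian if and only if $G$ is trail-colour-connected and has an eulerian factor. -/

import Mathlib

open scoped Graph

/-
A `2`-edge-coloured multigraph is a multigraph `G : Graph α β` together with a map
`φ : β → Fin 2` on edge labels, of which only the values on the edges of `G` matter.
-/

namespace Graph

variable {α β : Type*}

/-- `G.IsWalkFrom x w y`: starting at the vertex `x` and successively using, for each entry `(e, z)`
of the list `w`, the edge `e` to go to the vertex `z`, is a walk of `G` that ends at `y`. -/
def IsWalkFrom (G : Graph α β) : α → List (β × α) → α → Prop
  | x, [], y => x ∈ V(G) ∧ x = y
  | x, (e, z) :: w, y => G.IsLink e x z ∧ G.IsWalkFrom z w y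

/-- The sequence of edges used by a walk. -/
def walkEdges (w : List (β × α)) : List β := w.map Prod.fst

/-- Consecutive edges of the sequence have different colours. -/
def IsAlternating (φ : β → Fin 2) (es : List β) : Prop :=
  es.IsChain (fun e f => φ e ≠ φ f)

/-- Cyclically consecutive edges have different colours; in particular so have the last edge
and the first one. -/
def IsCyclicallyAlternating (φ : β → Fin 2) (es : List β) : Prop :=
  (es : Cycle β).Chain (fun e f => φ e ≠ φ f)

/-- An alternating `(x, y)`-trail: an alternating walk that repeats no edge. -/
def IsAlternatingTrail (G : Graph α β) (φ : β → Fin 2) (x : α) (w : List (β × α)) (y : α) : Prop :=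
  G.IsWalkFrom x w y ∧ (walkEdges w).Nodup ∧ IsAlternating φ (walkEdges w)

/-- A closed alternating trail with at least one edge. -/
def IsClosedAlternatingTrail (G : Graph α β) (φ : β → Fin 2) (x : α) (w : List (β × α)) : Prop :=
  w ≠ [] ∧ G.IsWalkFrom x w x ∧ (walkEdges w).Nodup ∧ IsCyclicallyAlternating φ (walkEdges w)

/-- There is a closed alternating trail through all the vertices. -/
def IsSupereulerian (G : Graph α β) (φ : β → Fin 2) : Prop :=
  ∃ (x : α) (w : List (β × α)), G.IsClosedAlternatingTrail φ x w ∧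
    ∀ v ∈ V(G), v ∈ w.map Prod.snd

/-- For all distinct vertices `u, v` there are alternating `(u, v)`-trails `T₁, T₂` such that
`T₁` followed by the reverse of `T₂` is an alternating closed walk. -/
def IsTrailColourConnected (G : Graph α β) (φ : β → Fin 2) : Prop :=
  ∀ u ∈ V(G), ∀ v ∈ V(G), u ≠ v → ∃ T₁ T₂ : List (β × α),
    G.IsAlternatingTrail φ u T₁ v ∧ G.IsAlternatingTrail φ u T₂ v ∧
    IsCyclicallyAlternating φ (walkEdges T₁ ++ (walkEdges T₂).reverse)

/-- Vertex-disjoint induced subgraphs that cover all the vertices, each of them supereulerian. -/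
def HasEulerianFactor (G : Graph α β) (φ : β → Fin 2) : Prop :=
  ∃ (k : ℕ) (W : Fin k → Set α), Pairwise (fun i j => Disjoint (W i) (W j)) ∧
    (⋃ i, W i) = V(G) ∧ ∀ i, (G.induce (W i)).IsSupereulerian φ

/-- The ends of every monochromatic path `x y z` of length two are adjacent. -/
def IsMClosed (G : Graph α β) (φ : β → Fin 2) : Prop :=
  ∀ ⦃e f : β⦄ ⦃x y z : α⦄, G.IsLink e x y → G.IsLink f y z → x ≠ z → φ e = φ f → G.Adj x z

/-- The graph obtained from a loopless graph `G` by replacing each vertex `v` by the independent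
set of the `p v` vertices `(v, 0), …, (v, p v - 1)`, and each edge `e` between `x` and `y` by one
edge, labelled `(e, s(a, b))`, between `a` and `b` for all copies `a` of `x` and `b` of `y`. -/
def extension (G : Graph α β) (p : α → ℕ) : Graph (α × ℕ) (β × Sym2 (α × ℕ)) where
  vertexSet := {a | a.1 ∈ V(G) ∧ a.2 < p a.1}
  IsLink d a b := G.IsLink d.1 a.1 b.1 ∧ a.2 < p a.1 ∧ b.2 < p b.1 ∧ d.2 = s(a, b)
  isLink_symm := by
    intro d _
    exact ⟨fun a b ⟨h, ha, hb, hd⟩ => ⟨h.symm, hb, ha, hd.trans Sym2.eq_swap⟩⟩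
  eq_or_eq_of_isLink_of_isLink := by
    rintro d a b a' b' ⟨_, _, _, h⟩ ⟨_, _, _, h'⟩
    rcases Sym2.eq_iff.1 (h.symm.trans h') with h | h
    · exact Or.inl h.1
    · exact Or.inr h.1
  left_mem_of_isLink := by
    rintro d a b ⟨h, ha, _, _⟩
    exact ⟨h.left_mem, ha⟩

/-- Each edge of an extension inherits the colour of the edge that it is a copy of. -/
def extensionColour (φ : β → Fin 2) : β × Sym2 (α × ℕ) → Fin 2 :=
  fun d => φ d.1

end Graph

/-! Call a set of edges balanced if it has equally many edges of either colour at every vertex. By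
an alternating form of Euler's argument, a connected balanced set that covers all vertices yields
the required closed trail (`IsBalancedCover.isSupereulerian`). An eulerian factor supplies a
balanced cover; let `F` be one whose connectedness relation is maximal. No exchange of edges can
then merge components of `F` (`IsMaxCover.conn_of_exchange`), which forbids alternating closed
trails and certain swaps between components.

Give two vertices in different components the sign of the colour of the edges joining them, or `0`
if there are none. For two edges of `F` of the same colour, M-closedness and the forbidden swaps
bound the sum of the four signs between their ends from one side; double counting over `F ×ˢ F`
turns this into equality (`IsMaxCover.block_sum_eq_zero`). Hence adjacent components are completely
joined, and moving along equally coloured edges of `F` at both ends reverses the sign. Forbidden 4-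
and 6-cycles then show that of two adjacent components exactly one dominates the other, and that
domination is a strict partial order.

A vertex of an undominated component is left by edges of at most one colour, and an alternating walk
from outside arrives at it only by that colour (`IsMaxCover.crossSign_of_altWalk`).
Trail-colour-connectedness would give two walks arriving by different colours, so there is only one
component. -/

namespace Graph

variable {α β : Type*}

/-! ### Alternating walks with prescribed colours at both ends -/

/-- `G.AltWalk φ c x w y d`: the list `w` describes an alternating walk of `G` from `x` to `y` whose
first edge has colour `c`, and which may be continued at `y` by an edge of colour `d`. -/
def AltWalk (G : Graph α β) (φ : β → Fin 2) : Fin 2 → α → List (β × α) → α → Fin 2 → Prop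
  | c, x, [], y, d => x ∈ V(G) ∧ x = y ∧ c = d
  | c, x, (e, z) :: w, y, d => G.IsLink e x z ∧ φ e = c ∧ G.AltWalk φ (c + 1) z w y d

lemma fin_two_ne_iff {c d : Fin 2} : c ≠ d ↔ d = c + 1 := by
  revert c d; decide

lemma fin_two_add_one_add_one (c : Fin 2) : c + 1 + 1 = c := by
  revert c; decide

lemma fin_two_add_one_ne (c : Fin 2) : c + 1 ≠ c := by
  revert c; decide

variable {G H : Graph α β} {φ : β → Fin 2} {c d f : Fin 2} {x y z u v : α} {w w' : List (β × α)}
  {e : β} {F : Finset β}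

@[simp] lemma walkEdges_nil : walkEdges ([] : List (β × α)) = [] := rfl

@[simp] lemma walkEdges_cons (a : β × α) (w : List (β × α)) :
    walkEdges (a :: w) = a.1 :: walkEdges w := rfl

@[simp] lemma walkEdges_append (w w' : List (β × α)) :
    walkEdges (w ++ w') = walkEdges w ++ walkEdges w' := List.map_append

@[simp] lemma length_walkEdges (w : List (β × α)) : (walkEdges w).length = w.length :=
  List.length_map ..

@[simp] lemma altWalk_nil : G.AltWalk φ c x [] y d ↔ x ∈ V(G) ∧ x = y ∧ c = d := Iff.rfl

@[simp] lemma altWalk_cons : G.AltWalk φ c x ((e, z) :: w) y d ↔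
    G.IsLink e x z ∧ φ e = c ∧ G.AltWalk φ (c + 1) z w y d := Iff.rfl

lemma AltWalk.left_mem (h : G.AltWalk φ c x w y d) : x ∈ V(G) := by
  match w, h with
  | [], h => exact h.1
  | (_, _) :: _, h => exact h.1.left_mem

lemma altWalk_append : G.AltWalk φ c x (w ++ w') y d ↔
    ∃ z f, G.AltWalk φ c x w z f ∧ G.AltWalk φ f z w' y d := by
  induction w generalizing c x with
  | nil =>
    constructor
    · intro h
      exact ⟨x, c, ⟨AltWalk.left_mem h, rfl, rfl⟩, h⟩
    · rintro ⟨z, f, ⟨-, rfl, rfl⟩, h⟩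
      exact h
  | cons a w ih =>
    obtain ⟨e, z⟩ := a
    simp only [List.cons_append, altWalk_cons, ih]
    constructor
    · rintro ⟨h, h', z', f, h1, h2⟩
      exact ⟨z', f, ⟨h, h', h1⟩, h2⟩
    · rintro ⟨z', f, ⟨h, h', h1⟩, h2⟩
      exact ⟨h, h', z', f, h1, h2⟩

lemma AltWalk.append (h : G.AltWalk φ c x w z f) (h' : G.AltWalk φ f z w' y d) :
    G.AltWalk φ c x (w ++ w') y d :=
  altWalk_append.2 ⟨z, f, h, h'⟩

lemma AltWalk.mono (hle : H ≤ G) (h : H.AltWalk φ c x w y d) : G.AltWalk φ c x w y d := by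
  induction w generalizing c x with
  | nil => exact ⟨hle.vertexSet_mono h.1, h.2⟩
  | cons a w ih => exact ⟨h.1.mono hle, h.2.1, ih h.2.2⟩

lemma AltWalk.isWalkFrom (h : G.AltWalk φ c x w y d) : G.IsWalkFrom x w y := by
  induction w generalizing c x with
  | nil => exact ⟨h.1, h.2.1⟩
  | cons a w ih => exact ⟨h.1, ih h.2.2⟩

lemma AltWalk.head_colour (h : G.AltWalk φ c x w y d) : ∀ e ∈ (walkEdges w).head?, φ e = c := by
  match w, h with
  | [], h => simp
  | (e, z) :: _, h => simpa using h.2.1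

lemma AltWalk.getLast_colour (h : G.AltWalk φ c x w y d) :
    ∀ e ∈ (walkEdges w).getLast?, d = φ e + 1 := by
  induction w generalizing c x with
  | nil => simp
  | cons a w ih =>
    obtain ⟨e, z⟩ := a
    obtain ⟨-, h1, h2⟩ := h
    match w, h2 with
    | [], h2 =>
      intro e' he'
      obtain rfl : e = e' := by simpa using he'
      rw [h1, h2.2.2]
    | a :: w', h2 =>
      intro e' he'
      exact ih h2 e' (by simpa [List.getLast?_cons_cons] using he')

lemma AltWalk.isAlternating (h : G.AltWalk φ c x w y d) : IsAlternating φ (walkEdges w) := by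
  induction w generalizing c x with
  | nil => simp [IsAlternating]
  | cons a w ih =>
    obtain ⟨e, z⟩ := a
    obtain ⟨-, h1, h2⟩ := h
    rw [walkEdges_cons, IsAlternating, List.isChain_cons]
    refine ⟨fun e' he' => ?_, ih h2⟩
    rw [fin_two_ne_iff, h2.head_colour e' he', h1]

lemma IsWalkFrom.exists_altWalk (h : G.IsWalkFrom x w y) (hw : IsAlternating φ (walkEdges w))
    (hc : ∀ e ∈ (walkEdges w).head?, φ e = c) : ∃ d, G.AltWalk φ c x w y d := by
  induction w generalizing c x with
  | nil => exact ⟨c, h.1, h.2, rfl⟩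
  | cons a w ih =>
    obtain ⟨e, z⟩ := a
    rw [walkEdges_cons, IsAlternating, List.isChain_cons] at hw
    have hec : φ e = c := hc e (by simp)
    obtain ⟨d, hd⟩ := ih (c := c + 1) h.2 hw.2 fun e' he' => by
      have := fin_two_ne_iff.1 (hw.1 e' he')
      rw [this, hec]
    exact ⟨d, h.1, hec, hd⟩

lemma isCyclicallyAlternating_iff {es : List β} : IsCyclicallyAlternating φ es ↔
    IsAlternating φ es ∧ ∀ e ∈ es.getLast?, ∀ e' ∈ es.head?, φ e ≠ φ e' := by
  cases es with
  | nil => simp [IsCyclicallyAlternating, IsAlternating]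
  | cons a l =>
    rw [IsCyclicallyAlternating, Cycle.chain_coe_cons, ← List.cons_append, List.isChain_append,
      IsAlternating]
    simp

lemma AltWalk.isCyclicallyAlternating (h : G.AltWalk φ c x w y c) :
    IsCyclicallyAlternating φ (walkEdges w) := by
  refine isCyclicallyAlternating_iff.2 ⟨h.isAlternating, fun e he e' he' => ?_⟩
  rw [fin_two_ne_iff, h.head_colour e' he', h.getLast_colour e he]

lemma IsWalkFrom.exists_altWalk_of_isCyclicallyAlternating (h : G.IsWalkFrom x w y)
    (hw : IsCyclicallyAlternating φ (walkEdges w)) : ∃ c, G.AltWalk φ c x w y c := by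
  match w, h, hw with
  | [], h, _ => exact ⟨0, h.1, h.2, rfl⟩
  | (e, z) :: w, h, hw =>
    rw [isCyclicallyAlternating_iff] at hw
    obtain ⟨d, hd⟩ := h.exists_altWalk (c := φ e) hw.1 (by simp)
    obtain rfl : d = φ e := by
      have hne : walkEdges ((e, z) :: w) ≠ [] := by simp
      have hl := List.getLast?_eq_some_getLast hne
      have h1 := hd.getLast_colour _ hl
      have h2 := fin_two_ne_iff.1 (hw.2 _ hl e (by simp))
      rw [h1, ← h2]
    exact ⟨φ e, hd⟩

/-- The reverse of a walk that starts at a given vertex. -/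
def revWalk : α → List (β × α) → List (β × α)
  | _, [] => []
  | x, (e, z) :: w => revWalk z w ++ [(e, x)]

lemma walkEdges_revWalk (x : α) (w : List (β × α)) :
    walkEdges (revWalk x w) = (walkEdges w).reverse := by
  induction w generalizing x with
  | nil => rfl
  | cons a w ih => simp [revWalk, ih]

/-- If `w` is nonempty, its last edge has colour `d + 1`; if it is empty, then `c = d` and the
shifted colours still agree. -/
lemma AltWalk.revWalk (h : G.AltWalk φ c x w y d) :
    G.AltWalk φ (d + 1) y (revWalk x w) x (c + 1) := by
  induction w generalizing c x with
  | nil =>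
    obtain ⟨h, rfl, rfl⟩ := h
    exact ⟨h, rfl, rfl⟩
  | cons a w ih =>
    obtain ⟨e, z⟩ := a
    obtain ⟨h1, h2, h3⟩ := h
    refine (ih h3).append ⟨h1.symm, ?_, h1.left_mem, rfl, ?_⟩
    · rw [h2, fin_two_add_one_add_one]
    · rw [fin_two_add_one_add_one]

lemma AltWalk.exists_split (h : G.AltWalk φ c x w y d) (hv : v ∈ w.map Prod.snd) :
    ∃ w₁ w₂ f, w = w₁ ++ w₂ ∧ G.AltWalk φ c x w₁ v f ∧ G.AltWalk φ f v w₂ y d := by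
  obtain ⟨⟨e, v'⟩, ha, rfl⟩ := List.mem_map.1 hv
  obtain ⟨s, t, rfl⟩ := List.append_of_mem ha
  rw [← List.singleton_append, ← List.append_assoc] at h ⊢
  obtain ⟨z, f, h1, h2⟩ := altWalk_append.1 h
  obtain ⟨z', f', -, -, -, -, rfl, -⟩ := altWalk_append.1 h1
  exact ⟨_, _, f, rfl, h1, h2⟩

/-- A closed alternating walk can be started at any of its vertices. -/
lemma AltWalk.exists_rotation (h : G.AltWalk φ c x w x c) (hv : v ∈ w.map Prod.snd) :
    ∃ w' d, w'.Perm w ∧ G.AltWalk φ d v w' v d := by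
  obtain ⟨w₁, w₂, f, rfl, h1, h2⟩ := h.exists_split hv
  exact ⟨w₂ ++ w₁, f, List.perm_append_comm, h2.append h1⟩

lemma AltWalk.exists_mem_walkEdges_inc (h : G.AltWalk φ c x w y d) (hv : v ∈ w.map Prod.snd) :
    ∃ e ∈ walkEdges w, G.Inc e v := by
  induction w generalizing c x with
  | nil => simp at hv
  | cons a w ih =>
    obtain ⟨e, z⟩ := a
    rcases List.mem_cons.1 hv with rfl | hv
    · exact ⟨e, by simp, h.1.inc_right⟩
    · obtain ⟨e', he', hi⟩ := ih h.2.2 hv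
      exact ⟨e', by simp [he'], hi⟩

lemma AltWalk.right_mem_map (h : G.AltWalk φ c x w y d) (hw : w ≠ []) : y ∈ w.map Prod.snd := by
  induction w generalizing c x with
  | nil => simp at hw
  | cons a w ih =>
    obtain ⟨e, z⟩ := a
    match w, h with
    | [], h => simp [h.2.2.2.1]
    | b :: w, h => exact List.mem_cons_of_mem _ (ih h.2.2 (by simp))

lemma AltWalk.mem_of_inc (h : G.AltWalk φ c x w y d) (he : e ∈ walkEdges w) (hi : G.Inc e v) :
    v = x ∨ v ∈ w.map Prod.snd := by
  induction w generalizing c x with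
  | nil => simp at he
  | cons a w ih =>
    obtain ⟨e', z⟩ := a
    rcases List.mem_cons.1 he with rfl | he
    · rcases hi.eq_or_eq_of_isLink h.1 with rfl | rfl <;> simp
    · rcases ih h.2.2 he with rfl | h'
      · simp
      · exact Or.inr (List.mem_cons_of_mem _ h')

lemma AltWalk.mem_map_of_inc (h : G.AltWalk φ c x w x d) (he : e ∈ walkEdges w)
    (hi : G.Inc e v) : v ∈ w.map Prod.snd := by
  rcases h.mem_of_inc he hi with rfl | h'
  · exact h.right_mem_map (by rintro rfl; simp at he)
  · exact h'

/-! ### A supereulerian graph is trail-colour-connected and has an eulerian factor -/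

/-- Rotate the closed trail to start at `u` and cut it at `v`: one arc is `T₁`, the reverse of the
other is `T₂`. -/
lemma IsSupereulerian.isTrailColourConnected (h : G.IsSupereulerian φ) :
    G.IsTrailColourConnected φ := by
  obtain ⟨x, w, ⟨-, hw, hnd, hcyc⟩, hall⟩ := h
  obtain ⟨c, hc⟩ := hw.exists_altWalk_of_isCyclicallyAlternating hcyc
  intro u hu v hv _
  obtain ⟨w', d, hp, hd⟩ := hc.exists_rotation (hall u hu)
  have hnd' : (walkEdges w').Nodup := ((hp.map Prod.fst).nodup_iff).2 hnd
  obtain ⟨T, S, f, rfl, hT, hS⟩ := hd.exists_split ((hp.map Prod.snd).mem_iff.2 (hall v hv))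
  rw [walkEdges_append, List.nodup_append] at hnd'
  refine ⟨T, revWalk v S, ⟨hT.isWalkFrom, hnd'.1, hT.isAlternating⟩,
    ⟨hS.revWalk.isWalkFrom, ?_, hS.revWalk.isAlternating⟩, ?_⟩
  · rw [walkEdges_revWalk, List.nodup_reverse]
    exact hnd'.2.1
  · rw [walkEdges_revWalk, List.reverse_reverse, ← walkEdges_append]
    exact hd.isCyclicallyAlternating

lemma IsSupereulerian.hasEulerianFactor (h : G.IsSupereulerian φ) : G.HasEulerianFactor φ :=
  ⟨1, fun _ => V(G), fun i j hij => absurd (Subsingleton.elim i j) hij, Set.iUnion_const _,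
    by simpa using h⟩

end Graph

namespace Graph

variable {α β : Type*} {G H : Graph α β} {φ : β → Fin 2} {c d f : Fin 2} {x y z u v : α}
  {w w' : List (β × α)} {e : β} {F : Finset β}

/-! ### Balanced sets of edges -/

/-- The sign of a colour. -/
def sgn (c : Fin 2) : ℤ := if c = 0 then 1 else -1

lemma sgn_add_one (c : Fin 2) : sgn (c + 1) = -sgn c := by
  revert c; decide

lemma sgn_mul_self (c : Fin 2) : sgn c * sgn c = 1 := by
  revert c; decide

lemma sgn_ne_zero (c : Fin 2) : sgn c ≠ 0 := by
  revert c; decide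

lemma sgn_eq_or_eq_neg (c d : Fin 2) : c = d ∧ sgn c = sgn d ∨ c ≠ d ∧ sgn c = -sgn d := by
  revert c d; decide

lemma sgn_eq_one_or (c : Fin 2) : sgn c = 1 ∨ sgn c = -1 := by
  revert c; decide

open scoped Classical in
/-- The indicator function of an incidence. -/
noncomputable def incInd (G : Graph α β) (e : β) (v : α) : ℤ := if G.Inc e v then 1 else 0

open scoped Classical in
lemma IsLink.incInd [G.Loopless] (h : G.IsLink e x y) (v : α) :
    G.incInd e v = (if v = x then 1 else 0) + (if v = y then 1 else 0) := by
  have hne := h.ne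
  by_cases hx : v = x
  · subst hx
    simp [Graph.incInd, h.inc_left, hne]
  · by_cases hy : v = y
    · subst hy
      simp [Graph.incInd, h.inc_right, hx]
    · have : ¬ G.Inc e v := fun hi => (hi.eq_or_eq_of_isLink h).elim hx hy
      simp [Graph.incInd, hx, hy, this]

/-- The number of edges of colour `0` minus the number of edges of colour `1` in `F` at `v`. -/
noncomputable def bal (G : Graph α β) (φ : β → Fin 2) (F : Finset β) (v : α) : ℤ :=
  ∑ e ∈ F, sgn (φ e) * G.incInd e v

open scoped Classical in
lemma bal_union_of_disjoint {A : Finset β} (h : Disjoint F A) (v : α) :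
    G.bal φ (F ∪ A) v = G.bal φ F v + G.bal φ A v :=
  Finset.sum_union h

open scoped Classical in
lemma bal_sdiff {A : Finset β} (h : A ⊆ F) (v : α) :
    G.bal φ (F \ A) v = G.bal φ F v - G.bal φ A v :=
  Finset.sum_sdiff_eq_sub h

-- Wherever the walk passes through a vertex, the two consecutive edges have opposite signs and
-- cancel. Only the two ends remain; the minus sign occurs because a last edge has colour `d + 1`.
open scoped Classical in
lemma AltWalk.bal_walkEdges [G.Loopless] (h : G.AltWalk φ c x w y d) (hw : (walkEdges w).Nodup)
    (v : α) : G.bal φ (walkEdges w).toFinset v =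
      sgn c * (if v = x then 1 else 0) - sgn d * (if v = y then 1 else 0) := by
  induction w generalizing c x with
  | nil =>
    obtain ⟨-, rfl, rfl⟩ := h
    simp [bal]
  | cons a w ih =>
    obtain ⟨e, z⟩ := a
    obtain ⟨h1, h2, h3⟩ := h
    rw [walkEdges_cons, List.nodup_cons] at hw
    have := ih h3 hw.2
    rw [bal] at this
    rw [walkEdges_cons, List.toFinset_cons, bal, Finset.sum_insert (by simpa using hw.1), this,
      h1.incInd, h2, sgn_add_one]
    ring

lemma exists_of_sgn_mul_bal_pos (h : 0 < sgn c * G.bal φ F v) :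
    ∃ e ∈ F, φ e = c ∧ G.Inc e v := by
  rw [bal, Finset.mul_sum] at h
  obtain ⟨e, he, hpos⟩ := Finset.exists_lt_of_sum_lt (s := F) (f := fun _ => (0 : ℤ))
    (by simpa using h)
  refine ⟨e, he, ?_⟩
  by_cases hi : G.Inc e v
  · refine ⟨?_, hi⟩
    rcases sgn_eq_or_eq_neg (φ e) c with h' | h'
    · exact h'.1
    · simp only [incInd, hi, if_true, h'.2] at hpos
      have := sgn_mul_self c
      linarith
  · simp [incInd, hi] at hpos

open scoped Classical in
/-- At a balanced vertex, an edge of some colour forces an edge of either colour. -/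
lemma exists_inc_of_bal_eq_zero (h : G.bal φ F v = 0) (he : e ∈ F) (hi : G.Inc e v) (c : Fin 2) :
    ∃ e ∈ F, φ e = c ∧ G.Inc e v := by
  rcases sgn_eq_or_eq_neg (φ e) c with h' | h'
  · exact ⟨e, he, h'.1, hi⟩
  · obtain ⟨e', he', h1⟩ := exists_of_sgn_mul_bal_pos (G := G) (φ := φ) (F := F \ {e}) (v := v)
      (c := c) (by
        rw [bal_sdiff (by simpa using he), h]
        simp only [bal, Finset.sum_singleton, incInd, hi, if_true, h'.2]
        have := sgn_mul_self c
        linarith)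
    exact ⟨e', (Finset.mem_sdiff.1 he').1, h1⟩

lemma exists_maximal_length {γ : Type*} {P : List γ → Prop} (hP : ∃ w, P w) (N : ℕ)
    (hN : ∀ w, P w → w.length ≤ N) : ∃ w, P w ∧ ∀ w', P w' → w'.length ≤ w.length := by
  classical
  let Q : ℕ → Prop := fun n => ∃ w, P w ∧ w.length = n
  obtain ⟨w₀, hw₀⟩ := hP
  have hQ : Q (Nat.findGreatest Q N) :=
    Nat.findGreatest_spec (P := Q) (hN w₀ hw₀) ⟨w₀, hw₀, rfl⟩
  obtain ⟨w, hw, hl⟩ := hQ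
  exact ⟨w, hw, fun w' hw' => hl ▸ Nat.le_findGreatest (hN w' hw') ⟨w', hw', rfl⟩⟩

lemma length_le_card_of_nodup (hw : (walkEdges w).Nodup) (hF : ∀ e ∈ walkEdges w, e ∈ F) :
    w.length ≤ F.card := by
  classical
  rw [← length_walkEdges, ← List.toFinset_card_of_nodup hw]
  exact Finset.card_le_card fun e he => hF e (List.mem_toFinset.1 he)

/-- In a balanced set of edges, every edge at `u` starts a closed alternating trail. -/
lemma exists_closed_altWalk [G.Loopless] (hF : ∀ v, G.bal φ F v = 0) (he : e ∈ F)
    (hi : G.Inc e u) : ∃ w ≠ [], G.AltWalk φ (φ e) u w u (φ e) ∧ (walkEdges w).Nodup ∧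
      ∀ e ∈ walkEdges w, e ∈ F := by
  classical
  obtain ⟨u', hl⟩ := hi
  obtain ⟨w, ⟨⟨y, d, hw⟩, hnd, hwF⟩, hmax⟩ := exists_maximal_length
    (P := fun w => (∃ y d, G.AltWalk φ (φ e) u w y d) ∧ (walkEdges w).Nodup ∧
      ∀ e ∈ walkEdges w, e ∈ F)
    ⟨[(e, u')], ⟨u', φ e + 1, hl, rfl, hl.right_mem, rfl, rfl⟩, by simp, by simpa using he⟩ F.card
    fun w hw => length_le_card_of_nodup hw.2.1 hw.2.2
  have hne : w ≠ [] := by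
    rintro rfl
    have := hmax [(e, u')]
      ⟨⟨u', φ e + 1, hl, rfl, hl.right_mem, rfl, rfl⟩, by simp, by simpa using he⟩
    simp at this
  by_cases hend : y = u ∧ d = φ e
  · obtain ⟨rfl, rfl⟩ := hend
    exact ⟨w, hne, hw, hnd, hwF⟩
  exfalso
  -- At `y` the unused edges have balance `sgn d`, or `2 * sgn d` if `y = u` and `d ≠ φ e`. So an
  -- unused edge of colour `d` prolongs the longest trail.
  obtain ⟨e', he', hc', y', hy'⟩ := exists_of_sgn_mul_bal_pos (G := G) (φ := φ)
    (F := F \ (walkEdges w).toFinset) (v := y) (c := d) (by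
      rw [bal_sdiff (fun a ha => hwF a (List.mem_toFinset.1 ha)), hF, hw.bal_walkEdges hnd]
      have h1 := sgn_mul_self d
      rcases sgn_eq_or_eq_neg (φ e) d with h' | h'
      · have : y ≠ u := fun h => hend ⟨h, h'.1.symm⟩
        simp [this, h1]
      · rw [h'.2, if_pos (rfl : y = y)]
        split_ifs <;> linarith)
  rw [Finset.mem_sdiff, List.mem_toFinset] at he'
  have := hmax (w ++ [(e', y')])
    ⟨⟨y', d + 1, hw.append ⟨hy', hc', hy'.right_mem, rfl, rfl⟩⟩, by
      rw [walkEdges_append, List.nodup_append]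
      refine ⟨hnd, by simp, ?_⟩
      rintro a ha b hb rfl
      simp only [walkEdges_cons, walkEdges_nil, List.mem_singleton] at hb
      exact he'.2 (hb ▸ ha), by
      intro a ha
      rw [walkEdges_append, List.mem_append] at ha
      rcases ha with ha | ha
      · exact hwF a ha
      · simp only [walkEdges_cons, walkEdges_nil, List.mem_singleton] at ha
        exact ha ▸ he'.1⟩
  simp at this

/-! ### Connectedness through a set of edges -/

/-- The vertices `x` and `y` are joined by a walk with all edges in `F`. -/
def Conn (G : Graph α β) (F : Finset β) : α → α → Prop :=
  Relation.ReflTransGen fun x y => ∃ e ∈ F, G.IsLink e x y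

lemma Conn.refl (x : α) : G.Conn F x x := Relation.ReflTransGen.refl

lemma Conn.symm (h : G.Conn F x y) : G.Conn F y x :=
  have : Std.Symm fun x y => ∃ e ∈ F, G.IsLink e x y := ⟨fun _ _ ⟨e, he, hl⟩ => ⟨e, he, hl.symm⟩⟩
  Std.Symm.symm (r := Relation.ReflTransGen _) _ _ h

lemma Conn.trans (h : G.Conn F x y) (h' : G.Conn F y z) : G.Conn F x z :=
  Relation.ReflTransGen.trans h h'

lemma IsLink.conn (h : G.IsLink e x y) (he : e ∈ F) : G.Conn F x y :=
  Relation.ReflTransGen.single ⟨e, he, h⟩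

lemma Conn.mono {F' : Finset β} (hF : ∀ e ∈ F, ∀ x y, G.IsLink e x y → G.Conn F' x y)
    (h : G.Conn F x y) : G.Conn F' x y := by
  induction h with
  | refl => exact Conn.refl _
  | tail _ h ih =>
    obtain ⟨e, he, hl⟩ := h
    exact ih.trans (hF e he _ _ hl)

lemma Conn.exists_inc (h : G.Conn F x y) (hne : x ≠ y) : ∃ e ∈ F, G.Inc e x := by
  rcases Relation.ReflTransGen.cases_head h with rfl | ⟨z, ⟨e, he, hl⟩, -⟩
  · exact absurd rfl hne
  · exact ⟨e, he, hl.inc_left⟩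

/-- A set `S` that contains `x` but not the vertex `y`, which is connected to `x`, is left by some
edge. -/
lemma Conn.exists_isLink_leaving (h : G.Conn F x y) {S : Set α} (hx : x ∈ S) (hy : y ∉ S) :
    ∃ e ∈ F, ∃ u ∈ S, ∃ v ∉ S, G.IsLink e u v := by
  induction h with
  | refl => exact absurd hx hy
  | @tail b c _ h ih =>
    obtain ⟨e, he, hl⟩ := h
    by_cases hb : b ∈ S
    · exact ⟨e, he, b, hb, c, hy, hl⟩
    · exact ih hb

/-- A set of edges is a balanced cover if every vertex is balanced and incident with an edge. -/
structure IsBalancedCover (G : Graph α β) (φ : β → Fin 2) (F : Finset β) : Prop where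
  bal_eq_zero : ∀ v, G.bal φ F v = 0
  exists_inc : ∀ v ∈ V(G), ∃ e ∈ F, G.Inc e v

/-- A connected balanced cover contains a closed alternating trail through all the vertices. -/
lemma IsBalancedCover.isSupereulerian [G.Loopless] (hF : G.IsBalancedCover φ F)
    (hne : V(G).Nonempty) (hconn : ∀ u ∈ V(G), ∀ v ∈ V(G), G.Conn F u v) :
    G.IsSupereulerian φ := by
  classical
  have hcl (a : α) (ha : a ∈ V(G)) : ∃ w ≠ [], (∃ x c, G.AltWalk φ c x w x c) ∧
      (walkEdges w).Nodup ∧ ∀ e ∈ walkEdges w, e ∈ F := by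
    obtain ⟨e, he, hi⟩ := hF.exists_inc a ha
    obtain ⟨w, hw, h1, h2⟩ := exists_closed_altWalk hF.bal_eq_zero he hi
    exact ⟨w, hw, ⟨a, _, h1⟩, h2⟩
  obtain ⟨a, ha⟩ := hne
  obtain ⟨w₀, hw₀, hP₀⟩ := hcl a ha
  obtain ⟨w, ⟨⟨x, c, hw⟩, hnd, hwF⟩, hmax⟩ := exists_maximal_length
    (P := fun w => (∃ x c, G.AltWalk φ c x w x c) ∧ (walkEdges w).Nodup ∧
      ∀ e ∈ walkEdges w, e ∈ F) ⟨w₀, hP₀⟩ F.card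
    fun w hw => length_le_card_of_nodup hw.2.1 hw.2.2
  have hwne : w ≠ [] := by
    rintro rfl
    exact hw₀ (List.eq_nil_of_length_eq_zero (Nat.le_zero.1 (hmax w₀ hP₀)))
  refine ⟨x, w, ⟨hwne, hw.isWalkFrom, hnd, hw.isCyclicallyAlternating⟩, ?_⟩
  by_contra! hv
  obtain ⟨v, hv, hvw⟩ := hv
  obtain ⟨e, he, u, hu, u', hu', hl⟩ := (hconn x hw.left_mem v hv).exists_isLink_leaving
    (S := {z | z ∈ w.map Prod.snd}) (hw.right_mem_map hwne) hvw
  obtain ⟨w', d, hp, hw'⟩ := hw.exists_rotation hu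
  have hpE : (walkEdges w').Perm (walkEdges w) := hp.map Prod.fst
  have hew : e ∉ walkEdges w := fun h => hu' (hw.mem_map_of_inc h hl.inc_right)
  have hbal (v : α) : G.bal φ (F \ (walkEdges w).toFinset) v = 0 := by
    rw [bal_sdiff (fun a ha => hwF a (List.mem_toFinset.1 ha)), hF.bal_eq_zero,
      hw.bal_walkEdges hnd]
    ring
  -- The unused edges are balanced, so one at `u` has the colour `d` with which the rotated trail
  -- starts. The closed trail that it starts can be spliced in at `u` without breaking alternation.
  obtain ⟨e', he', rfl, hi'⟩ := exists_inc_of_bal_eq_zero (hbal u) (e := e)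
    (by simp [he, hew]) hl.inc_left d
  obtain ⟨t, ht, ht1, ht2, ht3⟩ := exists_closed_altWalk hbal he' hi'
  have := hmax (w' ++ t) ⟨⟨u, _, hw'.append ht1⟩, by
    rw [walkEdges_append, List.nodup_append]
    refine ⟨hpE.nodup_iff.2 hnd, ht2, ?_⟩
    rintro a ha b hb rfl
    have := ht3 a hb
    simp only [Finset.mem_sdiff, List.mem_toFinset] at this
    exact this.2 (hpE.mem_iff.1 ha), by
    intro a ha
    rw [walkEdges_append, List.mem_append] at ha
    rcases ha with ha | ha
    · exact hwF a (hpE.mem_iff.1 ha)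
    · exact (Finset.mem_sdiff.1 (ht3 a ha)).1⟩
  rw [List.length_append, hp.length_eq] at this
  have := List.length_pos_of_ne_nil ht
  omega

/-- The edges of the closed trails of an eulerian factor form a balanced cover. -/
lemma HasEulerianFactor.exists_isBalancedCover [G.Loopless] (h : G.HasEulerianFactor φ) :
    ∃ F : Finset β, G.IsBalancedCover φ F ∧ ∀ e ∈ F, e ∈ E(G) := by
  classical
  obtain ⟨k, W, hdisj, hcov, hW⟩ := h
  have hsub (i : Fin k) : W i ⊆ V(G) := hcov ▸ Set.subset_iUnion W i
  have (i : Fin k) : ∃ x w c, (G.induce (W i)).AltWalk φ c x w x c ∧ (walkEdges w).Nodup ∧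
      ∀ v ∈ W i, v ∈ w.map Prod.snd := by
    obtain ⟨x, w, ⟨-, hw, hnd, hcyc⟩, hall⟩ := hW i
    obtain ⟨c, hc⟩ := hw.exists_altWalk_of_isCyclicallyAlternating hcyc
    exact ⟨x, w, c, hc, hnd, hall⟩
  choose x w c hw hnd hall using this
  have hwG (i : Fin k) := (hw i).mono (induce_le (hsub i))
  have hedge {i : Fin k} {e : β} (he : e ∈ walkEdges (w i)) : e ∈ E(G.induce (W i)) := by
    obtain ⟨a, ha, rfl⟩ := List.mem_map.1 he
    obtain ⟨s, t, hst⟩ := List.append_of_mem ha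
    have h := hw i
    rw [hst] at h
    obtain ⟨z, f, -, h2⟩ := altWalk_append.1 h
    exact h2.1.edge_mem
  refine ⟨Finset.univ.biUnion fun i => (walkEdges (w i)).toFinset, ⟨fun v => ?_, fun v hv => ?_⟩,
    fun e he => ?_⟩
  · rw [bal, Finset.sum_biUnion]
    · refine Finset.sum_eq_zero fun i _ => ?_
      have := (hwG i).bal_walkEdges (hnd i) v
      rw [sub_self] at this
      exact this
    -- An edge with its ends in `W i` has none in the disjoint set `W j`.
    · intro i _ j _ hij
      refine Finset.disjoint_left.2 fun e hei hej => ?_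
      obtain ⟨a, b, hl, ha, -⟩ := hedge (List.mem_toFinset.1 hei)
      obtain ⟨a', b', hl', ha', hb'⟩ := hedge (List.mem_toFinset.1 hej)
      rcases hl.left_eq_or_eq hl' with rfl | rfl
      · exact Set.disjoint_left.1 (hdisj hij) ha ha'
      · exact Set.disjoint_left.1 (hdisj hij) ha hb'
  · rw [← hcov] at hv
    obtain ⟨i, hi⟩ := Set.mem_iUnion.1 hv
    obtain ⟨e, he, hinc⟩ := (hwG i).exists_mem_walkEdges_inc (hall i v hi)
    exact ⟨e, Finset.mem_biUnion.2 ⟨i, Finset.mem_univ _, List.mem_toFinset.2 he⟩, hinc⟩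
  · obtain ⟨i, -, hi⟩ := Finset.mem_biUnion.1 he
    obtain ⟨a, b, hl, -⟩ := hedge (List.mem_toFinset.1 hi)
    exact hl.edge_mem

end Graph

namespace Graph

variable {α β : Type*} {G H : Graph α β} {φ : β → Fin 2} {c d : Fin 2} {x y z u v x' y' : α}
  {w w' : List (β × α)} {e f : β} {F R A : Finset β}

/-! ### Covers with maximal connectedness relation -/

/-- A balanced cover whose connectedness relation is maximal among the balanced covers. -/
structure IsMaxCover (G : Graph α β) (φ : β → Fin 2) (F : Finset β) : Prop
    extends G.IsBalancedCover φ F where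
  mem_edgeSet : ∀ e ∈ F, e ∈ E(G)
  conn_of_conn : ∀ F' : Finset β, G.IsBalancedCover φ F' → (∀ e ∈ F', e ∈ E(G)) →
    (∀ x y, G.Conn F x y → G.Conn F' x y) → ∀ x y, G.Conn F' x y → G.Conn F x y

/-- There are finitely many candidates; they are compared by inclusion of their connectedness
relations, not of the edge sets. -/
lemma IsBalancedCover.exists_isMaxCover (hE : E(G).Finite) (h : G.IsBalancedCover φ F)
    (hF : ∀ e ∈ F, e ∈ E(G)) : ∃ F, G.IsMaxCover φ F := by
  classical
  have hfin : {F : Finset β | G.IsBalancedCover φ F ∧ ∀ e ∈ F, e ∈ E(G)}.Finite := by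
    refine (hE.toFinset.powerset.finite_toSet).subset fun F hF => ?_
    simp only [Finset.coe_powerset, Set.mem_preimage, Set.mem_powerset_iff]
    intro e he
    simpa using hF.2 e he
  obtain ⟨F', hF', hmax⟩ := hfin.exists_maximalFor
    (fun F => {p : α × α | G.Conn F p.1 p.2}) _ ⟨F, h, hF⟩
  refine ⟨F', hF'.1, hF'.2, fun F'' h1 h2 h3 x y hxy => ?_⟩
  exact hmax (j := F'') ⟨h1, h2⟩ (fun p hp => h3 _ _ hp) (show (x, y) ∈ _ from hxy)

open scoped Classical in
/-- No exchange of edges that keeps the balance and the old connections creates a new one. -/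
lemma IsMaxCover.conn_of_exchange [G.Loopless] (h : G.IsMaxCover φ F) (hR : R ⊆ F)
    (hA : Disjoint F A) (hAE : ∀ e ∈ A, e ∈ E(G)) (hbal : ∀ v, G.bal φ A v = G.bal φ R v)
    (hconn : ∀ e ∈ R, ∀ u v, G.IsLink e u v → G.Conn (F \ R ∪ A) u v)
    (he : e ∈ A) (hl : G.IsLink e x y) : G.Conn F x y := by
  have hle (x y : α) (hxy : G.Conn F x y) : G.Conn (F \ R ∪ A) x y := by
    refine hxy.mono fun e he u v hl => ?_
    by_cases heR : e ∈ R
    · exact hconn e heR u v hl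
    · exact hl.conn (by simp [he, heR])
  refine h.conn_of_conn (F \ R ∪ A) ⟨fun v => ?_, fun v hv => ?_⟩ (fun e he => ?_) hle x y
    (hl.conn (by simp [he]))
  · rw [bal_union_of_disjoint (hA.mono_left Finset.sdiff_subset), bal_sdiff hR, h.bal_eq_zero, hbal]
    ring
  -- A vertex stays covered since it remains connected to its former neighbour.
  · obtain ⟨e, he, v', hl⟩ := h.exists_inc v hv
    exact (hle _ _ (hl.conn he)).exists_inc hl.ne
  · rcases Finset.mem_union.1 he with he | he
    · exact h.mem_edgeSet e (Finset.mem_sdiff.1 he).1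
    · exact hAE e he

open scoped Classical in
lemma IsLink.sum_incInd_mul [G.Loopless] (h : G.IsLink e x y) (S : Finset α) (g : α → ℤ) :
    ∑ v ∈ S, G.incInd e v * g v = (if x ∈ S then g x else 0) + (if y ∈ S then g y else 0) := by
  simp only [h.incInd, add_mul, Finset.sum_add_distrib, ite_mul, one_mul, zero_mul,
    Finset.sum_ite_eq']

open scoped Classical in
/-- By parity, deleting edges of a balanced set from different components disconnects nothing. -/
lemma conn_sdiff_of_bal_eq_zero [G.Loopless] (hV : V(G).Finite) (hF : ∀ v, G.bal φ F v = 0)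
    (hFE : ∀ e ∈ F, e ∈ E(G)) (hR : R ⊆ F) (he : e ∈ R) (hl : G.IsLink e x y)
    (hother : ∀ f ∈ R, f ≠ e → ∀ v, G.Inc f v → ¬ G.Conn F x v) : G.Conn (F \ R) x y := by
  by_contra hxy
  set P : Finset α := hV.toFinset.filter (G.Conn (F \ R) x) with hP
  have hmem (v : α) : v ∈ P ↔ v ∈ V(G) ∧ G.Conn (F \ R) x v := by simp [hP]
  have hsub (u v : α) (h : G.Conn (F \ R) u v) : G.Conn F u v :=
    h.mono fun e he u v hl => hl.conn (Finset.mem_sdiff.1 he).1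
  -- `P` is the component of `x` after the deletion, so each remaining edge has both ends or no end
  -- in `P` and contributes an even number.
  have heven : Even (∑ v ∈ P, G.bal φ (F \ R) v) := by
    simp only [bal]
    rw [Finset.sum_comm]
    refine Finset.even_sum _ fun f hf => ?_
    rw [← Finset.mul_sum]
    obtain ⟨a, b, hab⟩ := exists_isLink_of_mem_edgeSet (hFE f (Finset.mem_sdiff.1 hf).1)
    have h1 := hab.sum_incInd_mul P fun _ => 1
    simp only [mul_one] at h1
    have h2 : a ∈ P ↔ b ∈ P := by
      rw [hmem, hmem]
      exact ⟨fun h => ⟨hab.right_mem, h.2.trans (hab.conn hf)⟩,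
        fun h => ⟨hab.left_mem, h.2.trans (hab.symm.conn hf)⟩⟩
    rw [h1]
    by_cases hb : b ∈ P <;> simp [h2, hb]
  -- Of the deleted edges only `e` meets `P`, and only in `x`, so the same sum is odd.
  have hsum : ∑ v ∈ P, G.bal φ (F \ R) v = -sgn (φ e) := by
    simp only [bal_sdiff hR, hF, zero_sub, Finset.sum_neg_distrib, neg_inj]
    simp only [bal]
    rw [Finset.sum_comm, Finset.sum_eq_single e]
    · rw [← Finset.mul_sum]
      have h1 := hl.sum_incInd_mul P fun _ => 1
      simp only [mul_one] at h1
      have hx : x ∈ P := (hmem x).2 ⟨hl.left_mem, Conn.refl x⟩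
      have hy : y ∉ P := fun h => hxy ((hmem y).1 h).2
      simp [h1, hx, hy]
    · intro f hf hfe
      refine Finset.sum_eq_zero fun v hv => ?_
      have : ¬ G.Inc f v := fun hi => hother f hf hfe v hi (hsub _ _ ((hmem v).1 hv).2)
      simp [incInd, this]
    · exact fun h => absurd he h
  rw [hsum] at heven
  rcases sgn_eq_one_or (φ e) with h | h <;> rw [h] at heven <;> revert heven <;> decide

/-! ### Configurations that maximality forbids -/

/-- The vertices `x` and `y` are joined by an edge of colour `c`. -/
def ColAdj (G : Graph α β) (φ : β → Fin 2) (c : Fin 2) (x y : α) : Prop :=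
  ∃ e, G.IsLink e x y ∧ φ e = c

lemma ColAdj.symm (h : G.ColAdj φ c x y) : G.ColAdj φ c y x :=
  let ⟨e, hl, hc⟩ := h
  ⟨e, hl.symm, hc⟩

/-- A closed alternating trail without edges of a maximal cover stays in a component of it. -/
lemma IsMaxCover.conn_of_closed_altWalk [G.Loopless] (h : G.IsMaxCover φ F)
    (hw : G.AltWalk φ c u w u c) (hnd : (walkEdges w).Nodup) (hwF : ∀ e ∈ walkEdges w, e ∉ F)
    (he : e ∈ walkEdges w) (hl : G.IsLink e x y) : G.Conn F x y := by
  classical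
  refine h.conn_of_exchange (R := ∅) (A := (walkEdges w).toFinset) (by simp)
    (Finset.disjoint_right.2 fun e he => hwF e (List.mem_toFinset.1 he)) (fun e he => ?_)
    (fun v => ?_) (by simp) (List.mem_toFinset.2 he) hl
  · obtain ⟨a, ha, rfl⟩ := List.mem_map.1 (List.mem_toFinset.1 he)
    obtain ⟨s, t, rfl⟩ := List.append_of_mem ha
    obtain ⟨z, f, -, h2⟩ := altWalk_append.1 hw
    exact h2.1.edge_mem
  · rw [hw.bal_walkEdges hnd]
    simp [bal]

lemma IsLink.notMem_of_not_conn (hl : G.IsLink e x y) (h : ¬ G.Conn F x y) : e ∉ F :=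
  fun he => h (hl.conn he)

/-- Two parallel edges of different colours are a closed alternating trail of length two. -/
lemma IsMaxCover.not_colAdj_and_colAdj [G.Loopless] (h : G.IsMaxCover φ F)
    (hxy : ¬ G.Conn F x y) (h0 : G.ColAdj φ c x y) (h1 : G.ColAdj φ (c + 1) x y) : False := by
  obtain ⟨e, he, hec⟩ := h0
  obtain ⟨f, hf, hfc⟩ := h1
  have hef : e ≠ f := by
    rintro rfl
    exact fin_two_add_one_ne c (hfc.symm.trans hec)
  refine hxy (h.conn_of_closed_altWalk (c := c) (u := x) (w := [(e, y), (f, x)]) (e := e)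
    ⟨he, hec, hf.symm, hfc, he.left_mem, rfl, fin_two_add_one_add_one c⟩ (by simp [hef]) ?_
    (by simp) he)
  simp [he.notMem_of_not_conn hxy, hf.notMem_of_not_conn hxy]

lemma IsLink.edge_ne_of_ne (hl : G.IsLink e x y) (hl' : G.IsLink f x' y') (h : x ≠ x')
    (h' : x ≠ y') : e ≠ f := by
  rintro rfl
  exact (hl.left_eq_or_eq hl').elim h h'

lemma edge_ne_of_colour (he : φ e = c) (hf : φ f = c + 1) : e ≠ f := by
  rintro rfl
  exact fin_two_add_one_ne c (hf.symm.trans he)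

lemma ne_of_not_conn (h : ¬ G.Conn F x y) : x ≠ y := by
  rintro rfl
  exact h (Conn.refl x)

/-- There is no alternating `4`-cycle `x y x' y'` with all edges between components. -/
lemma IsMaxCover.not_alternating_four_cycle [G.Loopless] (h : G.IsMaxCover φ F)
    (hxy : ¬ G.Conn F x y) (hx'y : ¬ G.Conn F x' y) (hx'y' : ¬ G.Conn F x' y')
    (hxy' : ¬ G.Conn F x y') (hx : x ≠ x') (h1 : G.ColAdj φ c x y)
    (h2 : G.ColAdj φ (c + 1) x' y) (h3 : G.ColAdj φ c x' y') (h4 : G.ColAdj φ (c + 1) x y') :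
    False := by
  obtain ⟨e₁, l₁, c₁⟩ := h1
  obtain ⟨e₂, l₂, c₂⟩ := h2
  obtain ⟨e₃, l₃, c₃⟩ := h3
  obtain ⟨e₄, l₄, c₄⟩ := h4
  refine hxy (h.conn_of_closed_altWalk (c := c) (u := x) (e := e₁)
    (w := [(e₁, y), (e₂, x'), (e₃, y'), (e₄, x)]) ?_ ?_ ?_ (by simp) l₁)
  · simp only [altWalk_cons, altWalk_nil, fin_two_add_one_add_one]
    exact ⟨l₁, c₁, l₂.symm, c₂, l₃, c₃, l₄.symm, c₄, l₁.left_mem, by simp⟩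
  · have := edge_ne_of_colour c₁ c₂
    have := edge_ne_of_colour c₁ c₄
    have := edge_ne_of_colour c₃ c₂
    have := edge_ne_of_colour c₃ c₄
    have := l₁.edge_ne_of_ne l₃ hx (ne_of_not_conn hxy')
    have := l₂.edge_ne_of_ne l₄ hx.symm (ne_of_not_conn hx'y')
    simp only [walkEdges_cons, walkEdges_nil, List.nodup_cons, List.mem_cons, List.not_mem_nil]
    grind -ring
  · simp [l₁.notMem_of_not_conn hxy, l₂.notMem_of_not_conn hx'y, l₃.notMem_of_not_conn hx'y',
      l₄.notMem_of_not_conn hxy']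

/-- There is no alternating `6`-cycle with all edges between components. -/
lemma IsMaxCover.not_alternating_six_cycle [G.Loopless] (h : G.IsMaxCover φ F)
    {v₁ v₂ v₃ v₄ v₅ v₆ : α} (hnd : [v₁, v₂, v₃, v₄, v₅, v₆].Nodup)
    (n₁ : ¬ G.Conn F v₁ v₂) (n₂ : ¬ G.Conn F v₂ v₃) (n₃ : ¬ G.Conn F v₃ v₄)
    (n₄ : ¬ G.Conn F v₄ v₅) (n₅ : ¬ G.Conn F v₅ v₆) (n₆ : ¬ G.Conn F v₆ v₁)
    (h₁ : G.ColAdj φ c v₁ v₂) (h₂ : G.ColAdj φ (c + 1) v₂ v₃) (h₃ : G.ColAdj φ c v₃ v₄)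
    (h₄ : G.ColAdj φ (c + 1) v₄ v₅) (h₅ : G.ColAdj φ c v₅ v₆) (h₆ : G.ColAdj φ (c + 1) v₆ v₁) :
    False := by
  obtain ⟨e₁, l₁, c₁⟩ := h₁
  obtain ⟨e₂, l₂, c₂⟩ := h₂
  obtain ⟨e₃, l₃, c₃⟩ := h₃
  obtain ⟨e₄, l₄, c₄⟩ := h₄
  obtain ⟨e₅, l₅, c₅⟩ := h₅
  obtain ⟨e₆, l₆, c₆⟩ := h₆
  refine n₁ (h.conn_of_closed_altWalk (c := c) (u := v₁) (e := e₁)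
    (w := [(e₁, v₂), (e₂, v₃), (e₃, v₄), (e₄, v₅), (e₅, v₆), (e₆, v₁)]) ?_ ?_ ?_ (by simp) l₁)
  · simp only [altWalk_cons, altWalk_nil, fin_two_add_one_add_one]
    exact ⟨l₁, c₁, l₂, c₂, l₃, c₃, l₄, c₄, l₅, c₅, l₆, c₆, l₁.left_mem, by simp⟩
  · simp only [List.nodup_cons, List.mem_cons, List.not_mem_nil, or_false, not_or] at hnd
    obtain ⟨⟨-, a13, a14, a15, a16⟩, ⟨-, a24, a25, a26⟩, ⟨-, a35, a36⟩, ⟨-, a46⟩, -⟩ := hnd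
    have := l₁.edge_ne_of_ne l₃ a13 a14
    have := l₁.edge_ne_of_ne l₅ a15 a16
    have := l₃.edge_ne_of_ne l₅ a35 a36
    have := l₂.edge_ne_of_ne l₄ a24 a25
    have := l₂.symm.edge_ne_of_ne l₆ a36 (Ne.symm a13)
    have := l₄.edge_ne_of_ne l₆ a46 (Ne.symm a14)
    have := edge_ne_of_colour c₁ c₂
    have := edge_ne_of_colour c₁ c₄
    have := edge_ne_of_colour c₁ c₆
    have := edge_ne_of_colour c₃ c₂
    have := edge_ne_of_colour c₃ c₄
    have := edge_ne_of_colour c₃ c₆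
    have := edge_ne_of_colour c₅ c₂
    have := edge_ne_of_colour c₅ c₄
    have := edge_ne_of_colour c₅ c₆
    simp only [walkEdges_cons, walkEdges_nil, List.nodup_cons, List.mem_cons, List.not_mem_nil]
    grind -ring
  · simp [l₁.notMem_of_not_conn n₁, l₂.notMem_of_not_conn n₂, l₃.notMem_of_not_conn n₃,
      l₄.notMem_of_not_conn n₄, l₅.notMem_of_not_conn n₅, l₆.notMem_of_not_conn n₆]

/-- For edges `x x'` and `y y'` of the cover in different components that have the same colour,
`x y` and `x' y'` are not both joined by edges of this colour. -/
lemma IsMaxCover.not_colAdj_of_colAdj [G.Loopless] (hV : V(G).Finite) (h : G.IsMaxCover φ F)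
    (hxy : ¬ G.Conn F x y) (he : e ∈ F) (hel : G.IsLink e x x') (hec : φ e = c)
    (hf : f ∈ F) (hfl : G.IsLink f y y') (hfc : φ f = c) (h1 : G.ColAdj φ c x y)
    (h2 : G.ColAdj φ c x' y') : False := by
  classical
  obtain ⟨a, hal, hac⟩ := h1
  obtain ⟨b, hbl, hbc⟩ := h2
  have cx := hel.conn he
  have cy := hfl.conn hf
  have hx'y' : ¬ G.Conn F x' y' := fun h => hxy (cx.trans (h.trans cy.symm))
  have hxy' : ¬ G.Conn F x y' := fun h => hxy (h.trans cy.symm)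
  have hef : e ≠ f := hel.edge_ne_of_ne hfl (ne_of_not_conn hxy) (ne_of_not_conn hxy')
  have hab : a ≠ b := hal.edge_ne_of_ne hbl hel.ne (ne_of_not_conn hxy')
  have hR : ({e, f} : Finset β) ⊆ F := by
    intro g hg
    rcases Finset.mem_insert.1 hg with rfl | hg
    · exact he
    · exact Finset.mem_singleton.1 hg ▸ hf
  have hmono {u v : α} (h : G.Conn (F \ {e, f}) u v) : G.Conn (F \ {e, f} ∪ {a, b}) u v :=
    h.mono fun g hg u v hl => hl.conn (Finset.mem_union_left _ hg)
  -- As `e` and `f` lie in different components, parity allows both to be deleted without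
  -- disconnecting either component. The edge `a` would then merge the two.
  have kx : G.Conn (F \ {e, f} ∪ {a, b}) x x' := by
    refine hmono (conn_sdiff_of_bal_eq_zero hV h.bal_eq_zero h.mem_edgeSet hR (by simp) hel ?_)
    intro g hg hge v hv
    obtain rfl : g = f := by simpa [hge] using hg
    rcases hv.eq_or_eq_of_isLink hfl with rfl | rfl
    · exact hxy
    · exact hxy'
  have ky : G.Conn (F \ {e, f} ∪ {a, b}) y y' := by
    refine hmono (conn_sdiff_of_bal_eq_zero hV h.bal_eq_zero h.mem_edgeSet hR (by simp) hfl ?_)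
    intro g hg hge v hv
    obtain rfl : g = e := by simpa [hge] using hg
    rcases hv.eq_or_eq_of_isLink hel with rfl | rfl
    · exact fun h => hxy h.symm
    · exact fun h => hxy (cx.trans h.symm)
  refine hxy (h.conn_of_exchange (R := {e, f}) (A := {a, b}) (e := a) hR ?_ ?_ ?_ ?_ (by simp) hal)
  · rw [Finset.disjoint_right]
    simp [hal.notMem_of_not_conn hxy, hbl.notMem_of_not_conn hx'y']
  · simp [hal.edge_mem, hbl.edge_mem]
  · intro v
    simp only [bal, Finset.sum_pair hef, Finset.sum_pair hab, hel.incInd, hfl.incInd, hal.incInd,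
      hbl.incInd, hec, hfc, hac, hbc]
    ring
  · intro g hg u v huv
    have key {p q : α} (hl : G.IsLink g p q) (hk : G.Conn (F \ {e, f} ∪ {a, b}) p q) :
        G.Conn (F \ {e, f} ∪ {a, b}) u v := by
      rcases huv.eq_and_eq_or_eq_and_eq hl with ⟨rfl, rfl⟩ | ⟨rfl, rfl⟩
      · exact hk
      · exact hk.symm
    rcases Finset.mem_insert.1 hg with rfl | hg
    · exact key hel kx
    · rw [Finset.mem_singleton] at hg
      subst hg
      exact key hfl ky

/-- If an edge `y y'` of the cover in another component has colour `c`, and so have edges from `x`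
to `y` and from `x'` to `y'`, then no edge outside the cover that joins `x` and `x'` has the other
colour. -/
lemma IsMaxCover.not_isLink_of_colAdj [G.Loopless] (hV : V(G).Finite) (h : G.IsMaxCover φ F)
    (hxy : ¬ G.Conn F x y) (hx'y' : ¬ G.Conn F x' y') (he : e ∉ F) (hel : G.IsLink e x x')
    (hec : φ e = c + 1) (hf : f ∈ F) (hfl : G.IsLink f y y') (hfc : φ f = c)
    (h1 : G.ColAdj φ c x y) (h2 : G.ColAdj φ c x' y') : False := by
  classical
  obtain ⟨a, hal, hac⟩ := h1
  obtain ⟨b, hbl, hbc⟩ := h2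
  have cy := hfl.conn hf
  have hxy' : ¬ G.Conn F x y' := fun h => hxy (h.trans cy.symm)
  have hab : a ≠ b := hal.edge_ne_of_ne hbl hel.ne (ne_of_not_conn hxy')
  have hae := edge_ne_of_colour hac hec
  have hbe := edge_ne_of_colour hbc hec
  have ky : G.Conn (F \ {f} ∪ {a, b, e}) y y' := by
    refine (conn_sdiff_of_bal_eq_zero hV h.bal_eq_zero h.mem_edgeSet (R := {f}) (by simpa)
      (by simp) hfl ?_).mono fun g hg u v hl => hl.conn (Finset.mem_union_left _ hg)
    intro g hg hgf
    exact absurd (Finset.mem_singleton.1 hg) hgf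
  refine hxy (h.conn_of_exchange (R := {f}) (A := {a, b, e}) (e := a) (by simpa) ?_ ?_ ?_ ?_
    (by simp) hal)
  · rw [Finset.disjoint_right]
    simp [hal.notMem_of_not_conn hxy, hbl.notMem_of_not_conn hx'y', he]
  · simp [hal.edge_mem, hbl.edge_mem, hel.edge_mem]
  -- At `y` and `y'` the edges `a` and `b` take the place of `f`; at `x` and `x'` they are cancelled
  -- by `e`, which has the other colour.
  · intro v
    rw [bal, bal, Finset.sum_singleton, Finset.sum_insert (by simp [hab, hae]),
      Finset.sum_pair hbe]
    simp only [hel.incInd, hfl.incInd, hal.incInd, hbl.incInd, hec, hfc, hac, hbc, sgn_add_one]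
    ring
  · intro g hg u v huv
    rw [Finset.mem_singleton] at hg
    subst hg
    rcases huv.eq_and_eq_or_eq_and_eq hfl with ⟨rfl, rfl⟩ | ⟨rfl, rfl⟩
    · exact ky
    · exact ky.symm

end Graph

namespace Graph

variable {α β : Type*} {G : Graph α β} {φ : β → Fin 2} {c d : Fin 2} {a b x y z x' y' : α}
  {w : List (β × α)} {e f : β} {F : Finset β}

/-! ### Edges between the components of a maximal cover -/

/-- The ends of every monochromatic path of length two are adjacent, or have the same neighbours
in either colour. -/
def IsMClosedUpToTwins (G : Graph α β) (φ : β → Fin 2) : Prop :=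
  ∀ ⦃c x y z⦄, G.ColAdj φ c x y → G.ColAdj φ c y z → x ≠ z →
    G.Adj x z ∨ ∀ d u, G.ColAdj φ d x u ↔ G.ColAdj φ d z u

lemma IsBalancedCover.exists_isLink (h : G.IsBalancedCover φ F) (hx : x ∈ V(G)) (c : Fin 2) :
    ∃ e ∈ F, φ e = c ∧ ∃ x', G.IsLink e x x' := by
  obtain ⟨e, he, hi⟩ := h.exists_inc x hx
  exact exists_inc_of_bal_eq_zero (h.bal_eq_zero x) he hi c

lemma ColAdj.left_mem (h : G.ColAdj φ c x y) : x ∈ V(G) := h.choose_spec.1.left_mem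

lemma ColAdj.right_mem (h : G.ColAdj φ c x y) : y ∈ V(G) := h.choose_spec.1.right_mem

/-- Twins cannot lie in different components: for edges `x p` and `z q` of the cover of one colour,
the edges `x q` and `z p` have this colour too, a forbidden swap. -/
lemma IsMaxCover.exists_colAdj_of_mono [G.Loopless] (hV : V(G).Finite)
    (hM : G.IsMClosedUpToTwins φ) (h : G.IsMaxCover φ F) (hxz : ¬ G.Conn F x z)
    (h1 : G.ColAdj φ c x y) (h2 : G.ColAdj φ c y z) : ∃ d, G.ColAdj φ d x z := by
  rcases hM h1 h2 (ne_of_not_conn hxz) with ⟨e, he⟩ | htwin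
  · exact ⟨_, e, he, rfl⟩
  · exfalso
    obtain ⟨e, he, hec, p, hp⟩ := h.exists_isLink h1.left_mem 0
    obtain ⟨f, hf, hfc, q, hq⟩ := h.exists_isLink h2.right_mem 0
    exact h.not_colAdj_of_colAdj hV (fun h => hxz (h.trans (hq.symm.conn hf))) he hp hec hf
      hq.symm hfc ((htwin 0 q).2 ⟨f, hq, hfc⟩) (ColAdj.symm ((htwin 0 p).1 ⟨e, hp, hec⟩))

open scoped Classical in
/-- The sign of the colour of the edges between `x` and `y` if these are in different components;
it is `0` if there are none. -/
noncomputable def crossSign (G : Graph α β) (φ : β → Fin 2) (F : Finset β) (x y : α) : ℤ :=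
  if G.Conn F x y then 0 else if G.ColAdj φ 0 x y then 1 else if G.ColAdj φ 1 x y then -1 else 0

lemma crossSign_comm (x y : α) : G.crossSign φ F x y = G.crossSign φ F y x := by
  have h1 : G.Conn F x y = G.Conn F y x := propext ⟨Conn.symm, Conn.symm⟩
  have h2 (c : Fin 2) : G.ColAdj φ c x y = G.ColAdj φ c y x :=
    propext ⟨ColAdj.symm, ColAdj.symm⟩
  rw [crossSign, crossSign, h1, h2, h2]

lemma crossSign_of_conn (h : G.Conn F x y) : G.crossSign φ F x y = 0 := if_pos h

lemma not_conn_of_crossSign (h : G.crossSign φ F x y ≠ 0) : ¬ G.Conn F x y :=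
  fun h' => h (crossSign_of_conn h')

lemma crossSign_cases (x y : α) : G.crossSign φ F x y = 0 ∨ G.crossSign φ F x y = 1 ∨
    G.crossSign φ F x y = -1 := by
  unfold crossSign
  split_ifs <;> simp

lemma colAdj_of_crossSign (h : G.crossSign φ F x y = sgn c) : G.ColAdj φ c x y := by
  unfold crossSign at h
  fin_cases c
  · by_contra hn
    simp only [sgn, Fin.zero_eta, if_true] at h hn
    split_ifs at h <;> simp_all
  · by_contra hn
    simp only [sgn, Fin.mk_one, one_ne_zero, if_false] at h hn
    split_ifs at h

lemma exists_crossSign_eq_sgn (h : G.crossSign φ F x y ≠ 0) :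
    ∃ c, G.crossSign φ F x y = sgn c := by
  rcases crossSign_cases (G := G) (φ := φ) (F := F) x y with h' | h' | h'
  · exact absurd h' h
  · exact ⟨0, h'⟩
  · exact ⟨1, h'⟩

lemma left_mem_of_crossSign (h : G.crossSign φ F x y ≠ 0) : x ∈ V(G) := by
  obtain ⟨c, hc⟩ := exists_crossSign_eq_sgn h
  exact (colAdj_of_crossSign hc).left_mem

lemma right_mem_of_crossSign (h : G.crossSign φ F x y ≠ 0) : y ∈ V(G) :=
  left_mem_of_crossSign (crossSign_comm x y ▸ h)

lemma Conn.mem (h : G.Conn F x y) (hx : x ∈ V(G)) : y ∈ V(G) := by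
  rcases Relation.ReflTransGen.cases_tail h with rfl | ⟨z, -, e, -, hl⟩
  · exact hx
  · exact hl.right_mem

/-! ### Signs between two edges of the cover -/

namespace IsMaxCover

variable [G.Loopless]

/-- Edges joining two given vertices of different components have a single colour, so the precedence
of colour `0` in `crossSign` is immaterial. -/
lemma crossSign_eq_sgn (h : G.IsMaxCover φ F) (hxy : ¬ G.Conn F x y) (hc : G.ColAdj φ c x y) :
    G.crossSign φ F x y = sgn c := by
  have hn := h.not_colAdj_and_colAdj hxy (c := 0)
  fin_cases c
  · simp only [Fin.zero_eta] at hc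
    simp [crossSign, hxy, hc, sgn]
  · simp only [Fin.mk_one] at hc
    have : ¬ G.ColAdj φ 0 x y := fun h0 => hn h0 hc
    simp [crossSign, hxy, hc, sgn, this]

lemma crossSign_ne_zero (h : G.IsMaxCover φ F) (hxy : ¬ G.Conn F x y)
    (hc : ∃ c, G.ColAdj φ c x y) : G.crossSign φ F x y ≠ 0 := by
  obtain ⟨c, hc⟩ := hc
  rw [h.crossSign_eq_sgn hxy hc]
  exact sgn_ne_zero c

/-- The constraints on the four signs between two edges of the cover with the same colour. -/
lemma block_constraints (hV : V(G).Finite) (hM : G.IsMClosedUpToTwins φ) (h : G.IsMaxCover φ F)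
    (he : e ∈ F) (hel : G.IsLink e x x') (hf : f ∈ F) (hfl : G.IsLink f y y')
    (hef : φ e = φ f) :
    ¬ (G.crossSign φ F x y = sgn (φ e) ∧ G.crossSign φ F x' y' = sgn (φ e)) ∧
    (G.crossSign φ F x y = sgn (φ e) →
      G.crossSign φ F x' y ≠ 0 ∧ G.crossSign φ F x y' ≠ 0) := by
  constructor
  · rintro ⟨h1, h2⟩
    have hxy : ¬ G.Conn F x y := not_conn_of_crossSign (h1 ▸ sgn_ne_zero _)
    exact h.not_colAdj_of_colAdj hV hxy he hel rfl hf hfl hef.symm (colAdj_of_crossSign h1)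
      (colAdj_of_crossSign h2)
  -- The paths `x' x y` and `x y y'` are monochromatic.
  · intro h1
    have hxy : ¬ G.Conn F x y := not_conn_of_crossSign (h1 ▸ sgn_ne_zero _)
    have hc := colAdj_of_crossSign h1
    have hx'y : ¬ G.Conn F x' y := fun h => hxy ((hel.conn he).trans h)
    have hxy' : ¬ G.Conn F x y' := fun h => hxy (h.trans (hfl.symm.conn hf))
    exact ⟨h.crossSign_ne_zero hx'y (h.exists_colAdj_of_mono hV hM hx'y ⟨e, hel.symm, rfl⟩ hc),
      h.crossSign_ne_zero hxy' (h.exists_colAdj_of_mono hV hM hxy' hc ⟨f, hfl, hef.symm⟩)⟩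

/-- Arithmetic of the four signs of a block. -/
lemma block_arith {s p q r t : ℤ} (hs : s = 1 ∨ s = -1) (hp : p = 0 ∨ p = 1 ∨ p = -1)
    (hq : q = 0 ∨ q = 1 ∨ q = -1) (hr : r = 0 ∨ r = 1 ∨ r = -1) (ht : t = 0 ∨ t = 1 ∨ t = -1)
    (h1 : ¬ (p = s ∧ t = s) ∧ (p = s → r ≠ 0 ∧ q ≠ 0))
    (h2 : ¬ (q = s ∧ r = s) ∧ (q = s → t ≠ 0 ∧ p ≠ 0))
    (h3 : ¬ (r = s ∧ q = s) ∧ (r = s → p ≠ 0 ∧ t ≠ 0))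
    (h4 : ¬ (t = s ∧ p = s) ∧ (t = s → q ≠ 0 ∧ r ≠ 0)) :
    s * (p + q + r + t) ≤ 0 ∧ (p + q + r + t = 0 → t = -p ∧ (p ≠ 0 → r ≠ 0)) := by
  rcases hs with rfl | rfl <;> rcases hp with rfl | rfl | rfl <;>
    rcases hq with rfl | rfl | rfl <;> rcases hr with rfl | rfl | rfl <;>
    rcases ht with rfl | rfl | rfl <;> omega

/-- Let `s` be the sign of `φ e`. If some entry is `s`, its two neighbours in the block are nonzero
and the opposite entry is not `s`. So the entries `s` never outnumber the entries `-s`, and equality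
leaves only the zero block and blocks with two adjacent entries `s` and two entries `-s`. -/
lemma block_signs (hV : V(G).Finite) (hM : G.IsMClosedUpToTwins φ) (h : G.IsMaxCover φ F)
    (he : e ∈ F) (hel : G.IsLink e x x') (hf : f ∈ F) (hfl : G.IsLink f y y')
    (hef : φ e = φ f) :
    sgn (φ e) * (G.crossSign φ F x y + G.crossSign φ F x y' + G.crossSign φ F x' y +
      G.crossSign φ F x' y') ≤ 0 ∧
    (G.crossSign φ F x y + G.crossSign φ F x y' + G.crossSign φ F x' y +
      G.crossSign φ F x' y' = 0 → G.crossSign φ F x' y' = -G.crossSign φ F x y ∧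
        (G.crossSign φ F x y ≠ 0 → G.crossSign φ F x' y ≠ 0)) := by
  have h1 := h.block_constraints hV hM he hel hf hfl hef
  have h2 := h.block_constraints hV hM he hel hf hfl.symm hef
  have h3 := h.block_constraints hV hM he hel.symm hf hfl hef
  have h4 := h.block_constraints hV hM he hel.symm hf hfl.symm hef
  have k1 := crossSign_cases (G := G) (φ := φ) (F := F) x y
  have k2 := crossSign_cases (G := G) (φ := φ) (F := F) x y'
  have k3 := crossSign_cases (G := G) (φ := φ) (F := F) x' y
  have k4 := crossSign_cases (G := G) (φ := φ) (F := F) x' y'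
  exact block_arith (sgn_eq_one_or (φ e)) k1 k2 k3 k4 h1 h2 h3 h4

end IsMaxCover

/-! ### Double counting over pairs of edges -/

lemma sum_sgn_mul_sum_incInd (F : Finset β) (S : Finset α) (K : α → ℤ) :
    ∑ e ∈ F, sgn (φ e) * ∑ x ∈ S, G.incInd e x * K x = ∑ x ∈ S, G.bal φ F x * K x := by
  simp only [bal, Finset.mul_sum, Finset.sum_mul]
  rw [Finset.sum_comm]
  simp only [mul_assoc]

/-- The sum of the values of `g` over the pairs of an end of `e` and an end of `f`. -/
noncomputable def blockSum (G : Graph α β) (S : Finset α) (g : α → α → ℤ) (e f : β) : ℤ :=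
  ∑ x ∈ S, G.incInd e x * ∑ y ∈ S, G.incInd f y * g x y

lemma blockSum_comm (S : Finset α) {g : α → α → ℤ} (hg : ∀ x y, g x y = g y x) (e f : β) :
    G.blockSum S g e f = G.blockSum S g f e := by
  simp only [blockSum, Finset.mul_sum]
  rw [Finset.sum_comm]
  refine Finset.sum_congr rfl fun x _ => Finset.sum_congr rfl fun y _ => ?_
  rw [hg y x]
  ring

lemma blockSum_eq [G.Loopless] (hV : V(G).Finite) (g : α → α → ℤ) (hel : G.IsLink e x x')
    (hfl : G.IsLink f y y') :
    G.blockSum hV.toFinset g e f = g x y + g x y' + g x' y + g x' y' := by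
  classical
  simp only [blockSum, hel.sum_incInd_mul, hfl.sum_incInd_mul, Set.Finite.mem_toFinset,
    hel.left_mem, hel.right_mem, hfl.left_mem, hfl.right_mem, if_true]
  ring

/-- For fixed `f`, summing over `e` with weight `sgn (φ e)` produces the balances of the vertices,
which vanish; symmetry handles the other weight. -/
lemma sum_sgn_add_sgn_mul_blockSum (hF : ∀ v, G.bal φ F v = 0) (S : Finset α)
    {g : α → α → ℤ} (hg : ∀ x y, g x y = g y x) :
    ∑ p ∈ F ×ˢ F, (sgn (φ p.1) + sgn (φ p.2)) * G.blockSum S g p.1 p.2 = 0 := by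
  have key (f : β) : ∑ e ∈ F, sgn (φ e) * G.blockSum S g e f = 0 := by
    simp only [blockSum, sum_sgn_mul_sum_incInd, hF, zero_mul, Finset.sum_const_zero]
  simp only [add_mul, Finset.sum_add_distrib]
  rw [Finset.sum_product_right, Finset.sum_product]
  simp only [key, Finset.sum_const_zero, zero_add]
  refine Finset.sum_eq_zero fun e _ => ?_
  simp only [blockSum_comm S hg e, key]

namespace IsMaxCover

variable [G.Loopless]

/-- Double counting over all pairs of edges of the cover: all blocks have sum zero. -/
lemma block_sum_eq_zero (hV : V(G).Finite) (hM : G.IsMClosedUpToTwins φ)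
    (h : G.IsMaxCover φ F) (he : e ∈ F) (hel : G.IsLink e x x') (hf : f ∈ F)
    (hfl : G.IsLink f y y') (hef : φ e = φ f) :
    G.crossSign φ F x y + G.crossSign φ F x y' + G.crossSign φ F x' y +
      G.crossSign φ F x' y' = 0 := by
  have hsum := sum_sgn_add_sgn_mul_blockSum h.bal_eq_zero hV.toFinset
    (crossSign_comm (G := G) (φ := φ) (F := F))
  -- Pairs of different colours have weight `0`, and pairs of equal colour contribute at most `0` by
  -- `block_signs`. As the total is `0`, every term is.
  rw [Finset.sum_eq_zero_iff_of_nonpos] at hsum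
  · have := hsum (e, f) (Finset.mk_mem_product he hf)
    rw [blockSum_eq hV _ hel hfl, ← hef] at this
    have hs := sgn_ne_zero (φ e)
    rcases mul_eq_zero.1 this with h0 | h0
    · exact absurd h0 (by simp only; omega)
    · exact h0
  · rintro ⟨e, f⟩ hp
    rw [Finset.mem_product] at hp
    obtain ⟨p, p', hp'⟩ := exists_isLink_of_mem_edgeSet (h.mem_edgeSet e hp.1)
    obtain ⟨q, q', hq'⟩ := exists_isLink_of_mem_edgeSet (h.mem_edgeSet f hp.2)
    dsimp only
    rcases sgn_eq_or_eq_neg (φ e) (φ f) with hc | hc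
    · rw [blockSum_eq hV _ hp' hq', ← hc.2, add_mul]
      have := (h.block_signs hV hM hp.1 hp' hp.2 hq' hc.1).1
      linarith
    · rw [hc.2, neg_add_cancel, zero_mul]

lemma crossSign_eq_neg (hV : V(G).Finite) (hM : G.IsMClosedUpToTwins φ)
    (h : G.IsMaxCover φ F) (he : e ∈ F) (hel : G.IsLink e x x') (hf : f ∈ F)
    (hfl : G.IsLink f y y') (hef : φ e = φ f) :
    G.crossSign φ F x' y' = -G.crossSign φ F x y :=
  ((h.block_signs hV hM he hel hf hfl hef).2 (h.block_sum_eq_zero hV hM he hel hf hfl hef)).1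

/-- Every vertex meets edges of the cover of both colours, so each edge on the path from `x` to `x'`
has an equally coloured partner at `y`, and their block does not vanish. -/
lemma crossSign_ne_zero_of_conn_left (hV : V(G).Finite) (hM : G.IsMClosedUpToTwins φ)
    (h : G.IsMaxCover φ F) (hxy : G.crossSign φ F x y ≠ 0) (hx : G.Conn F x x') :
    G.crossSign φ F x' y ≠ 0 := by
  induction hx with
  | refl => exact hxy
  | tail _ hl ih =>
    obtain ⟨e, he, hl⟩ := hl
    obtain ⟨f, hf, hfe, y', hy'⟩ := h.exists_isLink (right_mem_of_crossSign ih) (φ e)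
    exact ((h.block_signs hV hM he hl hf hy' hfe.symm).2
      (h.block_sum_eq_zero hV hM he hl hf hy' hfe.symm)).2 ih

/-- Adjacent components are completely joined. -/
lemma crossSign_ne_zero_of_conn (hV : V(G).Finite) (hM : G.IsMClosedUpToTwins φ)
    (h : G.IsMaxCover φ F) (hxy : G.crossSign φ F x y ≠ 0) (hx : G.Conn F x x')
    (hy : G.Conn F y y') : G.crossSign φ F x' y' ≠ 0 := by
  have h1 := h.crossSign_ne_zero_of_conn_left hV hM hxy hx
  rw [crossSign_comm] at h1 ⊢
  exact h.crossSign_ne_zero_of_conn_left hV hM h1 hy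

end IsMaxCover

/-! ### Domination between components -/

/-- The components of `a` and `b` are adjacent, and the edges from any given vertex of the former
to the latter have the same colour. -/
def Dom (G : Graph α β) (φ : β → Fin 2) (F : Finset β) (a b : α) : Prop :=
  G.crossSign φ F a b ≠ 0 ∧ ∀ x, G.Conn F a x → ∀ y y', G.Conn F b y → G.Conn F b y' →
    G.crossSign φ F x y = G.crossSign φ F x y'

namespace IsMaxCover

variable [G.Loopless]

lemma exists_constant (hV : V(G).Finite) (hM : G.IsMClosedUpToTwins φ) (h : G.IsMaxCover φ F)
    (hab : G.crossSign φ F a b ≠ 0) :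
    (∃ x, G.Conn F a x ∧ ∀ y y', G.Conn F b y → G.Conn F b y' →
      G.crossSign φ F x y = G.crossSign φ F x y') ∨
    (∃ y, G.Conn F b y ∧ ∀ x x', G.Conn F a x → G.Conn F a x' →
      G.crossSign φ F y x = G.crossSign φ F y x') := by
  classical
  have hnc := not_conn_of_crossSign hab
  have hcross {x y : α} (hx : G.Conn F a x) (hy : G.Conn F b y) : ¬ G.Conn F x y :=
    fun h => hnc (hx.trans (h.trans hy.symm))
  have hfull {x y : α} (hx : G.Conn F a x) (hy : G.Conn F b y) :
      G.crossSign φ F x y = 1 ∨ G.crossSign φ F x y = -1 :=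
    (crossSign_cases x y).resolve_left (h.crossSign_ne_zero_of_conn hV hM hab hx hy)
  let N : α → Finset α := fun x =>
    hV.toFinset.filter fun y => G.Conn F b y ∧ G.crossSign φ F x y = 1
  have hN {x y : α} : y ∈ N x ↔ G.Conn F b y ∧ G.crossSign φ F x y = 1 := by
    simp only [N, Finset.mem_filter, Set.Finite.mem_toFinset, and_iff_right_iff_imp]
    exact fun hy => hy.1.mem (right_mem_of_crossSign hab)
  obtain ⟨x, hx, hmax⟩ := Finset.exists_max_image (hV.toFinset.filter (G.Conn F a))
    (fun x => (N x).card)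
    ⟨a, Finset.mem_filter.2 ⟨by simpa using left_mem_of_crossSign hab, Conn.refl a⟩⟩
  rw [Finset.mem_filter] at hx
  by_cases hall : ∀ y, G.Conn F b y → G.crossSign φ F x y = 1
  · exact Or.inl ⟨x, hx.2, fun y y' hy hy' => (hall y hy).trans (hall y' hy').symm⟩
  push Not at hall
  obtain ⟨y, hy, hxy⟩ := hall
  have hxy' := (hfull hx.2 hy).resolve_left hxy
  refine Or.inr ⟨y, hy, ?_⟩
  have hcol (z : α) (hz : G.Conn F a z) : G.crossSign φ F z y = -1 := by
    -- If `z` had sign `1` to `y`, then by maximality of `x` it would miss some `y'` in `N x`, and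
    -- `x y' z y` would be an alternating 4-cycle.
    refine (hfull hz hy).resolve_left fun hzy => ?_
    obtain ⟨y', hy', hzy'⟩ : ∃ y' ∈ N x, y' ∉ N z := by
      by_contra! hsub
      have hss : N x ⊂ N z := Finset.ssubset_iff_subset_ne.2
        ⟨hsub, fun heq => hxy (hN.1 (heq ▸ hN.2 ⟨hy, hzy⟩)).2⟩
      have := hmax z (Finset.mem_filter.2
        ⟨by simpa using hz.mem (left_mem_of_crossSign hab), hz⟩)
      exact absurd (Finset.card_lt_card hss) (not_lt.2 this)
    rw [hN] at hy' hzy'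
    have hzy'' := (hfull hz hy'.1).resolve_left fun h => hzy' ⟨hy'.1, h⟩
    refine h.not_alternating_four_cycle (c := 0) (x := x) (y := y') (x' := z) (y' := y)
      (hcross hx.2 hy'.1) (hcross hz hy'.1) (hcross hz hy) (hcross hx.2 hy) ?_
      (colAdj_of_crossSign hy'.2) (colAdj_of_crossSign hzy'') (colAdj_of_crossSign hzy)
      (colAdj_of_crossSign hxy')
    rintro rfl
    exact hxy hzy
  intro z z' hz hz'
  rw [crossSign_comm y, crossSign_comm y, hcol z hz, hcol z' hz']

/-- If the edges from one vertex of the component of `a` to the component of `b` have the same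
colour, this holds for all the vertices. -/
lemma dom_of_constant (hV : V(G).Finite) (hM : G.IsMClosedUpToTwins φ) (h : G.IsMaxCover φ F)
    (hab : G.crossSign φ F a b ≠ 0) (hx : G.Conn F a x)
    (hconst : ∀ y y', G.Conn F b y → G.Conn F b y' →
      G.crossSign φ F x y = G.crossSign φ F x y') : G.Dom φ F a b := by
  refine ⟨hab, fun z hz => ?_⟩
  have hxz : G.Conn F x z := hx.symm.trans hz
  clear hz
  induction hxz with
  | refl => exact hconst
  | tail _ hl ih =>
    obtain ⟨e, he, hl⟩ := hl
    intro y y' hy hy'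
    -- Partners of `e` at `y` and `y'` reduce the signs at the new vertex to negated signs at the
    -- previous one.
    obtain ⟨f, hf, hfe, q, hq⟩ := h.exists_isLink (hy.mem (right_mem_of_crossSign hab)) (φ e)
    obtain ⟨f', hf', hfe', q', hq'⟩ :=
      h.exists_isLink (hy'.mem (right_mem_of_crossSign hab)) (φ e)
    rw [h.crossSign_eq_neg hV hM he hl hf hq.symm hfe.symm,
      h.crossSign_eq_neg hV hM he hl hf' hq'.symm hfe'.symm,
      ih q q' (hy.trans (hq.conn hf)) (hy'.trans (hq'.conn hf'))]

lemma dom_or_dom (hV : V(G).Finite) (hM : G.IsMClosedUpToTwins φ) (h : G.IsMaxCover φ F)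
    (hab : G.crossSign φ F a b ≠ 0) : G.Dom φ F a b ∨ G.Dom φ F b a := by
  rcases h.exists_constant hV hM hab with ⟨x, hx, hc⟩ | ⟨y, hy, hc⟩
  · exact Or.inl (h.dom_of_constant hV hM hab hx hc)
  · exact Or.inr (h.dom_of_constant hV hM (crossSign_comm a b ▸ hab) hy hc)

/-- Crossing equally coloured edges at both ends reverses the sign, and domination makes the move at
the end `y` harmless. -/
lemma dom_neg (hV : V(G).Finite) (hM : G.IsMClosedUpToTwins φ) (h : G.IsMaxCover φ F)
    (hab : G.Dom φ F a b) (he : e ∈ F) (hl : G.IsLink e x x') (hx : G.Conn F a x)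
    (hy : G.Conn F b y) : G.crossSign φ F x' y = -G.crossSign φ F x y := by
  obtain ⟨f, hf, hfe, q, hq⟩ := h.exists_isLink (hy.mem (right_mem_of_crossSign hab.1)) (φ e)
  rw [h.crossSign_eq_neg hV hM he hl hf hq.symm hfe.symm,
    hab.2 x hx q y (hy.trans (hq.conn hf)) hy]

/-- Along an edge of the cover at `a` the sign to `b` flips, but `b` would see a constant sign on
the component of `a`. -/
lemma dom_asymm (hV : V(G).Finite) (hM : G.IsMClosedUpToTwins φ) (h : G.IsMaxCover φ F)
    (hab : G.Dom φ F a b) (hba : G.Dom φ F b a) : False := by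
  obtain ⟨e, he, -, a', hl⟩ := h.exists_isLink (left_mem_of_crossSign hab.1) 0
  have h1 := h.dom_neg hV hM hab he hl (Conn.refl a) (Conn.refl b)
  have h2 := hba.2 b (Conn.refl b) a a' (Conn.refl a) (hl.conn he)
  rw [crossSign_comm b, crossSign_comm b] at h2
  exact hab.1 (by omega)

lemma exists_pos_neg_of_dom (hV : V(G).Finite) (hM : G.IsMClosedUpToTwins φ)
    (h : G.IsMaxCover φ F) (hab : G.Dom φ F a b) :
    ∃ x y, G.Conn F a x ∧ G.Conn F a y ∧
      ∀ z, G.Conn F b z → G.crossSign φ F x z = 1 ∧ G.crossSign φ F y z = -1 := by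
  obtain ⟨e, he, -, a', hl⟩ := h.exists_isLink (left_mem_of_crossSign hab.1) 0
  have h1 (z : α) (hz : G.Conn F b z) := h.dom_neg hV hM hab he hl (Conn.refl a) hz
  have h2 (z : α) (hz : G.Conn F b z) := hab.2 a (Conn.refl a) z b hz (Conn.refl b)
  rcases (crossSign_cases a b).resolve_left hab.1 with h3 | h3
  · exact ⟨a, a', Conn.refl a, hl.conn he, fun z hz => by rw [h1 z hz, h2 z hz, h3]; simp⟩
  · exact ⟨a', a, hl.conn he, Conn.refl a, fun z hz => by rw [h1 z hz, h2 z hz, h3]; simp⟩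

/-- With a positive vertex `xᵢ` and a negative vertex `yᵢ` in each component, `x₁ y₂ x₃ y₁ x₂ y₃` is
an alternating 6-cycle. -/
lemma not_dom_cycle (hV : V(G).Finite) (hM : G.IsMClosedUpToTwins φ)
    (h : G.IsMaxCover φ F) {a₁ a₂ a₃ : α} (h₁ : G.Dom φ F a₁ a₂) (h₂ : G.Dom φ F a₂ a₃)
    (h₃ : G.Dom φ F a₃ a₁) : False := by
  obtain ⟨x₁, y₁, cx₁, cy₁, s₁⟩ := h.exists_pos_neg_of_dom hV hM h₁
  obtain ⟨x₂, y₂, cx₂, cy₂, s₂⟩ := h.exists_pos_neg_of_dom hV hM h₂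
  obtain ⟨x₃, y₃, cx₃, cy₃, s₃⟩ := h.exists_pos_neg_of_dom hV hM h₃
  have t₁ : G.crossSign φ F x₁ y₂ = sgn 0 := (s₁ y₂ cy₂).1
  have t₂ : G.crossSign φ F y₂ x₃ = sgn 1 := (s₂ x₃ cx₃).2
  have t₃ : G.crossSign φ F x₃ y₁ = sgn 0 := (s₃ y₁ cy₁).1
  have t₄ : G.crossSign φ F y₁ x₂ = sgn 1 := (s₁ x₂ cx₂).2
  have t₅ : G.crossSign φ F x₂ y₃ = sgn 0 := (s₂ y₃ cy₃).1
  have t₆ : G.crossSign φ F y₃ x₁ = sgn 1 := (s₃ x₁ cx₁).2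
  have nc {c : Fin 2} {x y : α} (hs : G.crossSign φ F x y = sgn c) : ¬ G.Conn F x y :=
    not_conn_of_crossSign (hs ▸ sgn_ne_zero c)
  have n₁₂ := not_conn_of_crossSign h₁.1
  have n₂₃ := not_conn_of_crossSign h₂.1
  have n₃₁ := not_conn_of_crossSign h₃.1
  have ne {p q x y : α} (hpq : ¬ G.Conn F p q) (hx : G.Conn F p x) (hy : G.Conn F q y) :
      x ≠ y := by
    rintro rfl
    exact hpq (hx.trans hy.symm)
  have d₁ : x₁ ≠ y₁ := by
    rintro rfl
    have := s₁ x₂ cx₂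
    omega
  have d₂ : x₂ ≠ y₂ := by
    rintro rfl
    have := s₂ x₃ cx₃
    omega
  have d₃ : x₃ ≠ y₃ := by
    rintro rfl
    have := s₃ x₁ cx₁
    omega
  refine h.not_alternating_six_cycle (c := 0) ?_ (nc t₁) (nc t₂) (nc t₃) (nc t₄) (nc t₅) (nc t₆)
    (colAdj_of_crossSign t₁) (colAdj_of_crossSign t₂) (colAdj_of_crossSign t₃)
    (colAdj_of_crossSign t₄) (colAdj_of_crossSign t₅) (colAdj_of_crossSign t₆)
  simp only [List.nodup_cons, List.mem_cons, List.not_mem_nil, or_false, not_or,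
    not_false_eq_true, List.nodup_nil, and_true]
  exact ⟨⟨ne n₁₂ cx₁ cy₂, (ne n₃₁ cx₃ cx₁).symm, d₁, ne n₁₂ cx₁ cx₂, (ne n₃₁ cy₃ cx₁).symm⟩,
    ⟨ne n₂₃ cy₂ cx₃, (ne n₁₂ cy₁ cy₂).symm, d₂.symm, ne n₂₃ cy₂ cy₃⟩,
    ⟨ne n₃₁ cx₃ cy₁, (ne n₂₃ cx₂ cx₃).symm, d₃⟩,
    ⟨ne n₁₂ cy₁ cx₂, (ne n₃₁ cy₃ cy₁).symm⟩, ne n₂₃ cx₂ cy₃⟩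

/-- The component of `x` has vertices of both signs towards `b`, so a monochromatic path of length
two leads through it from `a` to `b`. Hence `a` and `b` are adjacent, and `b` dominating `a` would
close a 3-cycle. -/
lemma dom_trans (hV : V(G).Finite) (hM : G.IsMClosedUpToTwins φ) (h : G.IsMaxCover φ F)
    (hab : G.Dom φ F a x) (hbc : G.Dom φ F x b) : G.Dom φ F a b := by
  have hnc : ¬ G.Conn F a b := by
    intro hconn
    refine h.dom_asymm hV hM hab ⟨?_, fun y hy p q hp hq =>
      hbc.2 y hy p q (hconn.symm.trans hp) (hconn.symm.trans hq)⟩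
    rw [crossSign_comm]
    exact hab.1
  obtain ⟨p, q, hp, hq, hs⟩ := h.exists_pos_neg_of_dom hV hM hbc
  have hs := hs b (Conn.refl b)
  obtain ⟨y, hy, c, h1, h2⟩ : ∃ y, G.Conn F x y ∧ ∃ c, G.crossSign φ F a y = sgn c ∧
      G.crossSign φ F y b = sgn c := by
    rcases (crossSign_cases a x).resolve_left hab.1 with h3 | h3
    · exact ⟨p, hp, 0, (hab.2 a (Conn.refl a) p x hp (Conn.refl x)).trans h3, hs.1⟩
    · exact ⟨q, hq, 1, (hab.2 a (Conn.refl a) q x hq (Conn.refl x)).trans h3, hs.2⟩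
  rcases h.dom_or_dom hV hM (h.crossSign_ne_zero hnc (h.exists_colAdj_of_mono hV hM hnc
    (colAdj_of_crossSign h1) (colAdj_of_crossSign h2))) with h3 | h3
  · exact h3
  · exact (h.not_dom_cycle hV hM hab hbc h3).elim

/-! ### Undominated components -/

/-- Some component is not dominated by another one. -/
lemma exists_not_dom (hV : V(G).Finite) (hne : V(G).Nonempty) (hM : G.IsMClosedUpToTwins φ)
    (h : G.IsMaxCover φ F) : ∃ a ∈ V(G), ∀ b, ¬ G.Dom φ F b a := by
  have : Finite V(G) := hV
  let r : V(G) → V(G) → Prop := fun p q => G.Dom φ F p q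
  have : IsTrans V(G) r := ⟨fun _ _ _ => h.dom_trans hV hM⟩
  have : Std.Irrefl r := ⟨fun _ hp => h.dom_asymm hV hM hp hp⟩
  obtain ⟨a, -, ha⟩ := (Finite.wellFounded_of_trans_of_irrefl r).has_min Set.univ
    ⟨⟨_, hne.some_mem⟩, trivial⟩
  exact ⟨a, a.2, fun b hb => ha ⟨b, left_mem_of_crossSign hb.1⟩ trivial hb⟩

/-- In an undominated component, the edges that leave it from a given vertex have one colour. -/
lemma crossSign_eq_of_not_dom (hV : V(G).Finite) (hM : G.IsMClosedUpToTwins φ)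
    (h : G.IsMaxCover φ F) (ha : ∀ b, ¬ G.Dom φ F b a) (hx : G.Conn F a x)
    (hy : G.crossSign φ F x y ≠ 0) (hy' : G.crossSign φ F x y' ≠ 0) :
    G.crossSign φ F x y = G.crossSign φ F x y' := by
  have hdom {y : α} (hy : G.crossSign φ F x y ≠ 0) : G.Dom φ F a y :=
    (h.dom_or_dom hV hM (h.crossSign_ne_zero_of_conn hV hM hy hx.symm (Conn.refl y))).resolve_right
      (ha y)
  obtain ⟨e, he, -, x', hl⟩ := h.exists_isLink (left_mem_of_crossSign hy) 0
  have h1 := h.dom_neg hV hM (hdom hy) he hl hx (Conn.refl y)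
  have h2 := h.dom_neg hV hM (hdom hy') he hl hx (Conn.refl y')
  obtain ⟨c, hc⟩ := exists_crossSign_eq_sgn hy
  obtain ⟨d, hd⟩ := exists_crossSign_eq_sgn hy'
  rcases sgn_eq_or_eq_neg d c with hcd | hcd
  · rw [hc, hd, hcd.1]
  exfalso
  rw [hcd.2] at hd
  rw [hc, ← sgn_add_one] at h1
  rw [hd, neg_neg] at h2
  rw [← sgn_add_one] at hd
  have nc {c : Fin 2} {x y : α} (hs : G.crossSign φ F x y = sgn c) : ¬ G.Conn F x y :=
    not_conn_of_crossSign (hs ▸ sgn_ne_zero c)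
  -- Both signs flip from `x` to `x'`, so differing signs at `x` make `x y x' y'` alternate.
  exact h.not_alternating_four_cycle (nc hc) (nc h1) (nc h2) (nc hd) hl.ne
    (colAdj_of_crossSign hc) (colAdj_of_crossSign h1) (colAdj_of_crossSign h2)
    (colAdj_of_crossSign hd)

/-- An alternating walk that comes from outside an undominated component arrives at each vertex of
this component by the colour of the edges that leave the component from there. -/
lemma crossSign_of_altWalk (hV : V(G).Finite) (hM : G.IsMClosedUpToTwins φ)
    (h : G.IsMaxCover φ F) (ha : ∀ b, ¬ G.Dom φ F b a) (hw : G.AltWalk φ c x w y d)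
    (hx : G.Conn F a x → ∃ z, G.crossSign φ F x z = sgn (c + 1)) :
    G.Conn F a y → ∃ z, G.crossSign φ F y z = sgn (d + 1) := by
  induction w generalizing c x with
  | nil =>
    obtain ⟨-, rfl, rfl⟩ := hw
    exact hx
  | cons p w ih =>
    obtain ⟨e, x'⟩ := p
    obtain ⟨hl, hec, hw⟩ := hw
    refine ih hw fun hx' => ?_
    rw [fin_two_add_one_add_one]
    by_cases hax : G.Conn F a x
    · obtain ⟨z, hz⟩ := hx hax
      have hz0 : G.crossSign φ F x z ≠ 0 := hz ▸ sgn_ne_zero _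
      have hdom : G.Dom φ F a z := (h.dom_or_dom hV hM
        (h.crossSign_ne_zero_of_conn hV hM hz0 hax.symm (Conn.refl z))).resolve_right (ha z)
      have hz' : G.crossSign φ F x' z ≠ 0 :=
        h.crossSign_ne_zero_of_conn hV hM hdom.1 hx' (Conn.refl z)
      obtain ⟨k, hk⟩ := exists_crossSign_eq_sgn hz'
      refine ⟨z, ?_⟩
      rw [hk]
      -- Otherwise edges of colour `c + 1` leave the component from both `x` and `x'`, while `e` has
      -- colour `c`. Inside `F` this contradicts the sign reversal; outside `F`, an edge `z z'` of
      -- the cover could be exchanged for `e` and edges `x z`, `x' z'`.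
      by_contra hkc
      obtain rfl : k = c + 1 := fin_two_ne_iff.1 fun hck => hkc (hck ▸ rfl)
      by_cases heF : e ∈ F
      · have := h.dom_neg hV hM hdom heF hl hax (Conn.refl z)
        rw [hk, hz] at this
        have := sgn_ne_zero (c + 1)
        omega
      · obtain ⟨f, hf, hfc, z', hzz'⟩ := h.exists_isLink (right_mem_of_crossSign hz0) (c + 1)
        have hk' : G.crossSign φ F x' z' = sgn (c + 1) :=
          (hdom.2 x' hx' z' z (hzz'.conn hf) (Conn.refl z)).trans hk
        exact h.not_isLink_of_colAdj hV (not_conn_of_crossSign hz0)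
          (not_conn_of_crossSign (hk' ▸ sgn_ne_zero _)) heF hl
          (hec.trans (fin_two_add_one_add_one c).symm) hf hzz' hfc (colAdj_of_crossSign hz)
          (colAdj_of_crossSign hk')
    -- When the walk enters the component, `e` itself is an edge leaving it from `x'`.
    · exact ⟨x, h.crossSign_eq_sgn (fun hc => hax (hx'.trans hc)) ⟨e, hl.symm, hec⟩⟩

end IsMaxCover

end Graph

/-! ### Connectedness of the maximal cover -/

namespace Graph

variable {α β : Type*} {G : Graph α β} {φ : β → Fin 2} {x y u v : α} {F : Finset β}

/-- The last edges of `T₁` and `T₂` are consecutive in the closed walk, so the trails arrive at `v`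
by different colours. Nothing else about the closed walk is needed. -/
lemma IsTrailColourConnected.exists_altWalk (h : G.IsTrailColourConnected φ) (hu : u ∈ V(G))
    (hv : v ∈ V(G)) (huv : u ≠ v) : ∃ T₁ T₂ c₁ c₂ d, G.AltWalk φ c₁ u T₁ v d ∧
      G.AltWalk φ c₂ u T₂ v (d + 1) := by
  obtain ⟨T₁, T₂, ⟨hw₁, -, ha₁⟩, ⟨hw₂, -, ha₂⟩, hcyc⟩ := h u hu v hv huv
  have hne {T : List (β × α)} (hw : G.IsWalkFrom u T v) : walkEdges T ≠ [] := by
    intro hT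
    rw [walkEdges, List.map_eq_nil_iff] at hT
    subst hT
    exact huv hw.2
  have hwalk {T : List (β × α)} (hw : G.IsWalkFrom u T v) (ha : IsAlternating φ (walkEdges T)) :
      ∃ c d, G.AltWalk φ c u T v d := by
    have hd := List.head?_eq_some_head (hne hw)
    obtain ⟨d, hd⟩ := hw.exists_altWalk (c := φ ((walkEdges T).head (hne hw))) ha fun e he => by
      rw [hd, Option.mem_some_iff] at he
      rw [he]
    exact ⟨_, d, hd⟩
  obtain ⟨c₁, d₁, h₁⟩ := hwalk hw₁ ha₁
  obtain ⟨c₂, d₂, h₂⟩ := hwalk hw₂ ha₂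
  have l₁ := List.getLast?_eq_some_getLast (hne hw₁)
  have l₂ := List.getLast?_eq_some_getLast (hne hw₂)
  have hlast := (List.isChain_append.1 (isCyclicallyAlternating_iff.1 hcyc).1).2.2 _ l₁ _
    (by rw [List.head?_reverse]; exact l₂)
  obtain rfl : d₂ = d₁ + 1 := by
    rw [h₁.getLast_colour _ l₁, h₂.getLast_colour _ l₂, fin_two_ne_iff.1 hlast]
  exact ⟨T₁, T₂, c₁, c₂, d₁, h₁, h₂⟩

/-- In a trail-colour-connected graph, a maximal cover is connected. -/
lemma IsMaxCover.conn [G.Loopless] (hV : V(G).Finite) (hM : G.IsMClosedUpToTwins φ)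
    (hT : G.IsTrailColourConnected φ) (h : G.IsMaxCover φ F) (hx : x ∈ V(G)) (hy : y ∈ V(G)) :
    G.Conn F x y := by
  obtain ⟨a, haV, ha⟩ := h.exists_not_dom hV ⟨x, hx⟩ hM
  have key (v : α) (hv : v ∈ V(G)) : G.Conn F a v := by
    by_contra hav
    obtain ⟨T₁, T₂, c₁, c₂, d, h₁, h₂⟩ := hT.exists_altWalk hv haV (ne_of_not_conn hav).symm
    obtain ⟨z₁, hz₁⟩ := h.crossSign_of_altWalk hV hM ha h₁ (fun hc => absurd hc hav)
      (Conn.refl a)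
    obtain ⟨z₂, hz₂⟩ := h.crossSign_of_altWalk hV hM ha h₂ (fun hc => absurd hc hav)
      (Conn.refl a)
    have heq := h.crossSign_eq_of_not_dom hV hM ha (Conn.refl a) (hz₁ ▸ sgn_ne_zero _)
      (hz₂ ▸ sgn_ne_zero _)
    rw [hz₁, hz₂, sgn_add_one (d + 1)] at heq
    have := sgn_ne_zero (d + 1)
    omega
  exact (key x hx).symm.trans (key y hy)

theorem isSupereulerian_iff_of_isMClosedUpToTwins [G.Loopless] (hV : V(G).Finite)
    (hE : E(G).Finite) (hne : V(G).Nonempty) (hM : G.IsMClosedUpToTwins φ) :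
    G.IsSupereulerian φ ↔ G.IsTrailColourConnected φ ∧ G.HasEulerianFactor φ := by
  refine ⟨fun h => ⟨h.isTrailColourConnected, h.hasEulerianFactor⟩, fun ⟨hT, hfac⟩ => ?_⟩
  obtain ⟨F₀, hF₀, hF₀E⟩ := hfac.exists_isBalancedCover
  obtain ⟨F, hF⟩ := hF₀.exists_isMaxCover hE hF₀E
  exact hF.toIsBalancedCover.isSupereulerian hne fun u hu v hv => hF.conn hV hM hT hu hv

/-! ### Extensions -/

lemma extension_loopless (hloop : G.Loopless) (p : α → ℕ) : (G.extension p).Loopless :=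
  ⟨fun d a h => hloop.not_isLoopAt d.1 a.1 h.1⟩

lemma finite_vertexSet_extension (hV : V(G).Finite) (p : α → ℕ) :
    V(G.extension p).Finite := by
  refine (hV.biUnion fun x _ => (Set.finite_Iio (p x)).image fun i => (x, i)).subset ?_
  rintro ⟨x, i⟩ ⟨hx, hi⟩
  exact Set.mem_biUnion hx ⟨i, hi, rfl⟩

lemma finite_edgeSet_extension (hV : V(G).Finite) (hE : E(G).Finite) (p : α → ℕ) :
    E(G.extension p).Finite := by
  have hV' := finite_vertexSet_extension hV p
  refine (hE.prod ((hV'.prod hV').image fun q => s(q.1, q.2))).subset ?_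
  intro d hd
  obtain ⟨a, b, hab⟩ := exists_isLink_of_mem_edgeSet hd
  exact ⟨hab.1.edge_mem, (a, b), ⟨hab.left_mem, hab.right_mem⟩, hab.2.2.2.symm⟩

lemma colAdj_extension_iff {p : α → ℕ} {c : Fin 2} {a b : α × ℕ} :
    (G.extension p).ColAdj (extensionColour φ) c a b ↔
      G.ColAdj φ c a.1 b.1 ∧ a.2 < p a.1 ∧ b.2 < p b.1 := by
  constructor
  · rintro ⟨d, ⟨hl, ha, hb, -⟩, hc⟩
    exact ⟨⟨d.1, hl, hc⟩, ha, hb⟩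
  · rintro ⟨⟨e, hl, hc⟩, ha, hb⟩
    exact ⟨(e, s(a, b)), ⟨hl, ha, hb, rfl⟩, hc⟩

/-- Copies of one vertex are never adjacent, so M-closedness may fail in an extension, but such
copies are twins; copies of different vertices inherit adjacency. -/
lemma IsMClosed.isMClosedUpToTwins_extension (hM : G.IsMClosed φ) (p : α → ℕ) :
    (G.extension p).IsMClosedUpToTwins (extensionColour φ) := by
  intro c a b a' h1 h2 _
  rw [colAdj_extension_iff] at h1 h2
  obtain ⟨⟨e, he, hec⟩, ha, hb⟩ := h1
  obtain ⟨⟨f, hf, hfc⟩, -, ha'⟩ := h2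
  by_cases haa' : a.1 = a'.1
  · refine Or.inr fun d u => ?_
    rw [colAdj_extension_iff, colAdj_extension_iff, haa']
    simp only [haa' ▸ ha, ha']
  · obtain ⟨g, hg⟩ := hM he hf haa' (hec.trans hfc.symm)
    exact Or.inl ⟨(g, s(a, a')), hg, ha, ha', rfl⟩

end Graph

theorem mainTheorem1 {α β : Type*} (G : Graph α β) (φ : β → Fin 2)
    (hV : V(G).Finite) (hE : E(G).Finite) (hloop : G.Loopless) (hn : V(G).Nontrivial)
    (hM : G.IsMClosed φ)
    (p : α → ℕ) (hp : ∀ v ∈ V(G), 1 ≤ p v) :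
    (G.extension p).IsSupereulerian (Graph.extensionColour φ) ↔
      (G.extension p).IsTrailColourConnected (Graph.extensionColour φ) ∧
        (G.extension p).HasEulerianFactor (Graph.extensionColour φ) := by
  have := Graph.extension_loopless hloop p
  obtain ⟨x, hx⟩ := hn.nonempty
  exact Graph.isSupereulerian_iff_of_isMClosedUpToTwins
    (Graph.finite_vertexSet_extension hV p) (Graph.finite_edgeSet_extension hV hE p)
    ⟨(x, 0), hx, hp x hx⟩ (hM.isMClosedUpToTwins_extension p)
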